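/- Let $\mathcal X,\mathcal Y,\mathcal Z$ be finite sets, let $(X,Y)$ be a pair of stationary memoryless sources with joint law $\mu_{XY}$ on $\mathcal X\times\mathcal Y$, and fix a conditional distribution $\mu_{Z|Y}$. Put $\mu_{XYZ}(x,y,z)=\mu_{XY}(x,y)\,\mu_{Z|Y}(z|y)$; all entropies and mutual informations refer to this law, $\log=\log_2$, and $\mu_{XY}(\boldsymbol x,\boldsymbol y)$, $\mu_{Z|Y}(\boldsymbol z|\boldsymbol y)$, $\mu_Z(\boldsymbol z)$, $\mu_{X|Z}(\boldsymbol x|\boldsymbol z)$ denote the products over the $n$ letters. Let $$\zeta_{\mathcal Z}(\gamma)=\gamma-\sqrt{2\gamma}\,\log\frac{\sqrt{2\gamma}}{|\mathcal Z|},\qquad \zeta_{\mathcal X\mathcal Z}(\gamma)=\gamma-\sqrt{2\gamma}\,\log\frac{\sqrt{2\gamma}}{|\mathcal X||\mathcal Z|}.$$ **Hash property.** For each $n$ let $\mathcal A=\mathcal A_n$ be a finite set of functions $A:\mathcal U^n\to\overline{\mathcal U}_n$ with finite range set $\overline{\mathcal U}_n$, let $p_A$ be a probability distribution on $\mathcal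 A$, and let $\mathrm{Im}\mathcal A=\bigcup_{A\in\mathcal A}A(\mathcal U^n)$. The sequence of ensembles $(\mathcal A,p_A)$ has a hash property if $\frac1n\log\frac{|\overline{\mathcal U}_n|}{|\mathrm{Im}\mathcal A|}\to0$ and there are real sequences $\alpha(n)\to1$, $\beta(n)\to0$ such that for all $n\ge1$ and all $\mathcal T,\mathcal T'\subset\mathcal U^n$ $$\sum_{\boldsymbol u\in\mathcal T,\ \boldsymbol u'\in\mathcal T'}p_A(\{A:A\boldsymbol u=A\boldsymbol u'\})\le|\mathcal T\cap\mathcal T'|+\frac{|\mathcal T||\mathcal T'|\alpha(n)}{|\mathrm{Im}\mathcal A|}+\min\{|\mathcal T|,|\mathcal T'|\}\,\beta(n).$$ **Theorem.** Let $\varepsilon_{\mathcal A},\varepsilon_{\mathcal B},\varepsilon_{\widehat{\mathcal B}}>0$ satisfy $$\varepsilon_{\mathcal B}>\varepsilon_{\mathcal A}+\zeta_{\mathcal Z}(3\varepsilon_{\mathcal A}),\qquad \varepsilon_{\widehat{\mathcal B}}>2\,\zeta_{\mathcal X\mathcal Z}(3\varepsilon_{\mathcal A}).$$ For every $n\ge1$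 let $l_{\mathcal A},l_{\mathcal B},l_{\widehat{\mathcal B}}$ be nonnegative integers with $$l_{\mathcal A}=\frac{n[H(Z|Y)-\varepsilon_{\mathcal A}]}{\log|\mathcal Z|},\qquad l_{\mathcal B}=\frac{n[I(Y;Z)+\varepsilon_{\mathcal B}]}{\log|\mathcal Z|},\qquad l_{\widehat{\mathcal B}}=\frac{n[H(X|Z)+\varepsilon_{\widehat{\mathcal B}}]}{\log|\mathcal X|},$$ where each equality is understood up to rounding of the right-hand side to a neighbouring integer (an absolute error less than $1$, so that there is equality when the right-hand side is an integer). Let $\mathcal A$, $\mathcal B$, $\widehat{\mathcal B}$ be ensembles of functions $A:\mathcal Z^n\to\mathcal Z^{l_{\mathcal A}}$, $B:\mathcal Z^n\to\mathcal Z^{l_{\mathcal B}}$, $\widehat B:\mathcal X^n\to\mathcal X^{l_{\widehat{\mathcal B}}}$, each having a hash property. Then for every $\delta>0$ and all sufficiently large $n$ the following holds. Let $$g_A(\boldsymbol c|\boldsymbol y)=\arg\max_{\boldsymbol z':A\boldsymbol z'=\boldsymbol c}\mu_{Z|Y}(\boldsymbol z'|\boldsymbol y),\quad g_{AB}(\boldsymbol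 c,\boldsymbol b)=\arg\max_{\boldsymbol z':A\boldsymbol z'=\boldsymbol c,\,B\boldsymbol z'=\boldsymbol b}\mu_Z(\boldsymbol z'),\quad g_{\widehat B}(\boldsymbol b|\boldsymbol z)=\arg\max_{\boldsymbol x':\widehat B\boldsymbol x'=\boldsymbol b}\mu_{X|Z}(\boldsymbol x'|\boldsymbol z),$$ with any fixed tie-breaking rule, and any fixed value where the constraint set is empty. Then there are $A\in\mathcal A$, $B\in\mathcal B$, $\widehat B\in\widehat{\mathcal B}$ and $\boldsymbol c\in\mathrm{Im}\mathcal A$ such that the code with encoders $\varphi_X(\boldsymbol x)=\widehat B\boldsymbol x$ and $\varphi_Y(\boldsymbol y)=B\,g_A(\boldsymbol c|\boldsymbol y)$ and decoder $\varphi^{-1}(\boldsymbol b_X,\boldsymbol b_Y)=g_{\widehat B}(\boldsymbol b_X|g_{AB}(\boldsymbol c,\boldsymbol b_Y))$ has rates $$R_X=\frac{l_{\widehat{\mathcal B}}\log|\mathcal X|}n=H(X|Z)+\varepsilon_{\widehat{\mathcal B}},\qquad R_Y=\frac{l_{\mathcal B}\log|\mathcal Z|}n=I(Y;Z)+\varepsilon_{\mathcal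 B}$$ (up to the rounding of the lengths: the deviations are less than $\log|\mathcal X|/n$ and $\log|\mathcal Z|/n$ respectively, and each is zero when the corresponding unrounded length is an integer) and error probability $$\mu_{XY}\big(\{(\boldsymbol x,\boldsymbol y):\varphi^{-1}(\varphi_X(\boldsymbol x),\varphi_Y(\boldsymbol y))\ne\boldsymbol x\}\big)\le\delta.$$ -/

import Mathlib

open Filter Topology Finset

noncomputable section

namespace HelpCode

/-! ### Information measures on finite alphabets (logarithms to base `2`) -/

/-- `H(p) = ∑ u, p(u) log (1 / p(u))`. -/
def entropy {U : Type*} [Fintype U] (p : U → ℝ) : ℝ :=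
  ∑ u, p u * Real.logb 2 (1 / p u)

/-- `H(q | p) = ∑ u, v, q(u | v) p(v) log (1 / q(u | v))`; here `q v u` is `q(u | v)`. -/
def condEntropy {U V : Type*} [Fintype U] [Fintype V] (q : V → U → ℝ) (p : V → ℝ) : ℝ :=
  ∑ v, ∑ u, q v u * p v * Real.logb 2 (1 / q v u)

/-- The marginal `μ_U` of a joint distribution `μ_{UV}`. -/
def margFst {U V : Type*} [Fintype V] (p : U × V → ℝ) (u : U) : ℝ := ∑ v, p (u, v)

/-- The marginal `μ_V` of a joint distribution `μ_{UV}`. -/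
def margSnd {U V : Type*} [Fintype U] (p : U × V → ℝ) (v : V) : ℝ := ∑ u, p (u, v)

/-- The conditional distribution `μ_{U|V}(u | v)` of a joint distribution `μ_{UV}`
(equal to `0` where `μ_V(v) = 0`). -/
def condFst {U V : Type*} [Fintype U] (p : U × V → ℝ) (v : V) (u : U) : ℝ :=
  p (u, v) / margSnd p v

/-- `H(U | V) = H(μ_{U|V} | μ_V)`. -/
def condEntropyOf {U V : Type*} [Fintype U] [Fintype V] (p : U × V → ℝ) : ℝ :=
  condEntropy (condFst p) (margSnd p)

/-- `I(U; V) = H(U) - H(U | V)`. -/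
def mutualInfo {U V : Type*} [Fintype U] [Fintype V] (p : U × V → ℝ) : ℝ :=
  entropy (margFst p) - condEntropyOf p

/-- `ζ_𝒰(γ) = γ - √(2γ) log (√(2γ) / |𝒰|)`, as a function of `k = |𝒰|` and `γ`. -/
def zetaFun (k : ℕ) (γ : ℝ) : ℝ :=
  γ - √(2 * γ) * Real.logb 2 (√(2 * γ) / k)

/-- Probability of a sequence under the memoryless extension of `p`. -/
def seqProb {U : Type*} {n : ℕ} (p : U → ℝ) (u : Fin n → U) : ℝ := ∏ i, p (u i)

/-- Conditional probability of the sequence `u` given `v` under the memoryless extension of the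
conditional distribution `q`. -/
def seqCondProb {U V : Type*} {n : ℕ} (q : V → U → ℝ) (v : Fin n → V) (u : Fin n → U) : ℝ :=
  ∏ i, q (v i) (u i)

/-! ### Ensembles of functions and the hash property -/

/-- A finite set `fns` of functions `α → β` together with a probability distribution on it. -/
structure Ensemble (α β : Type*) where
  fns : Finset (α → β)
  prob : (α → β) → ℝ
  prob_nonneg : ∀ A ∈ fns, 0 ≤ prob A
  sum_prob : ∑ A ∈ fns, prob A = 1

/-- `Im 𝒜 = ⋃_{A ∈ 𝒜} {A u : u}`. -/
def Ensemble.im {α β : Type*} [Fintype α] [DecidableEq β] (E : Ensemble α β) : Finset β :=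
  E.fns.biUnion fun A => univ.image A

/-- The probability of `{A : A u = A u'}`. -/
def Ensemble.collisionProb {α β : Type*} [DecidableEq β] (E : Ensemble α β) (u u' : α) : ℝ :=
  ∑ A ∈ E.fns with A u = A u', E.prob A

/-- The `(a, b)`-hash property of a sequence of ensembles of functions `𝒰ⁿ → V n`. -/
structure HasHashPropertyWith {U : Type*} [Fintype U] [DecidableEq U] {V : ℕ → Type*}
    [∀ n, Fintype (V n)] [∀ n, DecidableEq (V n)]
    (E : ∀ n, Ensemble (Fin n → U) (V n)) (a b : ℕ → ℝ) : Prop where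
  im_large : Tendsto
    (fun n : ℕ => Real.logb 2 ((Fintype.card (V n) : ℝ) / ((E n).im.card : ℝ)) / (n : ℝ))
    atTop (𝓝 0)
  tendsto_one : Tendsto a atTop (𝓝 1)
  tendsto_zero : Tendsto b atTop (𝓝 0)
  hash : ∀ n, 0 < n → ∀ T T' : Finset (Fin n → U),
    ∑ u ∈ T, ∑ u' ∈ T', (E n).collisionProb u u' ≤
      ((T ∩ T').card : ℝ)
        + (T.card : ℝ) * (T'.card : ℝ) * a n / ((E n).im.card : ℝ)
        + (min T.card T'.card : ℕ) * b n

/-- A sequence of ensembles has a hash property. -/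
def HasHashProperty {U : Type*} [Fintype U] [DecidableEq U] {V : ℕ → Type*}
    [∀ n, Fintype (V n)] [∀ n, DecidableEq (V n)]
    (E : ∀ n, Ensemble (Fin n → U) (V n)) : Prop :=
  ∃ a b : ℕ → ℝ, HasHashPropertyWith E a b

/-! ### The code -/

/-- `𝒞_A(c) = {u : A u = c}`. -/
def coset {α β : Type*} (A : α → β) (c : β) : Set α := {u | A u = c}

/-- `𝒞_{AB}(c, b) = {u : A u = c, B u = b}`. -/
def cosetPair {α β γ : Type*} (A : α → β) (B : α → γ) (c : β) (b : γ) : Set α :=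
  {u | A u = c ∧ B u = b}

/-- `x` is a legitimate value of `arg max_{x' ∈ S} f(x')`: a maximizer, ties being broken
arbitrarily; nothing is required of `x` when `S` is empty. -/
def IsArgmax {α : Type*} (S : Set α) (f : α → ℝ) (x : α) : Prop :=
  S.Nonempty → x ∈ S ∧ IsMaxOn f S x

/-- The nonnegative integer `l` is `t / log k` up to rounding to one of the neighbouring integers
(and is equal to it when it is an integer). -/
def IsLength (l k : ℕ) (t : ℝ) : Prop :=
  |(l : ℝ) * Real.logb 2 k - t| < Real.logb 2 k

/-- The rate `l log k / n` in bits per source letter. -/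
def rate (l k n : ℕ) : ℝ := (l : ℝ) * Real.logb 2 k / n

/-- `μ_{YZ}(y, z)` for `μ_{XYZ}(x, y, z) = μ_{XY}(x, y) μ_{Z|Y}(z | y)`. -/
def jointYZ {X Y Z : Type*} [Fintype X] (μ : X × Y → ℝ) (W : Y → Z → ℝ) (p : Y × Z) : ℝ :=
  ∑ x, μ (x, p.1) * W p.1 p.2

/-- `μ_{XZ}(x, z)` for `μ_{XYZ}(x, y, z) = μ_{XY}(x, y) μ_{Z|Y}(z | y)`. -/
def jointXZ {X Y Z : Type*} [Fintype Y] (μ : X × Y → ℝ) (W : Y → Z → ℝ) (p : X × Z) : ℝ :=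
  ∑ y, μ (p.1, y) * W y p.2

/-- The probability, under the memoryless source `μ`, that the decoder `dec`, fed with the
codewords `encX x` and `encY y`, does not output `x`. -/
def errorProb {X Y MX MY : Type*} [Fintype X] [DecidableEq X] [Fintype Y] {n : ℕ}
    (μ : X × Y → ℝ) (encX : (Fin n → X) → MX) (encY : (Fin n → Y) → MY)
    (dec : MX → MY → (Fin n → X)) : ℝ :=
  ∑ p : (Fin n → X) × (Fin n → Y) with dec (encX p.1) (encY p.2) ≠ p.1,
    seqProb μ fun i => (p.1 i, p.2 i)

end HelpCode

end

open HelpCode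

namespace HelpCode

/-! The code comes from averaging over `A`, `c`, `B` and `Bh`. Let `z = gA A c y`, and let `M` be
the size of `Im 𝒜`. An error forces one of four events. (1) The coset of `c` contains no `z` with
likelihood at least `θ₁` given `y`. By a second-moment argument (`Ensemble.HashBound.saturation`) a
random coset meets every set much larger than `M`, and the typical set is that large because the
rate of `A` is below H(Z|Y). (2) The selected `z` is likely given `y`, but its `Z`-likelihood, or
the likelihood of `x` given `z`, is abnormally low. (3) `B` fails to identify `z` within its coset.
(4) `Bh` fails to identify `x` given `z`. Events (3) and (4) are collision estimates for a single
random hash function.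

Event (2) is the heart: `z` is a maximizer, not a sample from the channel, so joint typicality with
`x` is not automatic. Distinct cosets select distinct `z`, each of mass at least `θ₁`. Averaged over
`c`, the probability of a bad selection is therefore at most `1 / (θ₁ M)`, about `2^(n εA)`, times
its probability under the memoryless law μ_XYZ (`sum_selected_le`). The bad events must thus have
exponent strictly above `εA`. The function ζ provides this: a log-likelihood exceeds its mean by
ζ(3ε) per letter with probability at most `2^(-nε)` (`exists_exponent`), and any larger margin gives
a strictly better exponent.

`exists_code` combines the four bounds for arbitrary thresholds. The main theorem inserts
exponential thresholds and sees every term vanish. -/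

theorem exists_le_of_weighted_sum_le {ι : Type*} {s : Finset ι} {w f : ι → ℝ} {δ : ℝ}
    (hw : ∀ i ∈ s, 0 ≤ w i) (hs : ∑ i ∈ s, w i = 1) (h : ∑ i ∈ s, w i * f i ≤ δ) :
    ∃ i ∈ s, f i ≤ δ := by
  by_contra! hc
  have h0 : 0 ≤ ∑ i ∈ s, w i * (δ - f i) := by
    have : ∑ i ∈ s, w i * (δ - f i) = δ - ∑ i ∈ s, w i * f i := by
      simp only [mul_sub, sum_sub_distrib, ← sum_mul, hs, one_mul]
    linarith
  have hle : ∀ i ∈ s, w i * (δ - f i) ≤ 0 := fun i hi =>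
    mul_nonpos_of_nonneg_of_nonpos (hw i hi) (by linarith [hc i hi])
  have hz := (sum_eq_zero_iff_of_nonpos hle).1 (le_antisymm (sum_nonpos hle) h0)
  have : ∑ i ∈ s, w i = 0 := sum_eq_zero fun i hi => by
    rcases mul_eq_zero.1 (hz i hi) with h | h
    · exact h
    · linarith [hc i hi]
  linarith

/-! ### Hash property: saturation of cosets and collisions -/

/-- The collision bound of the hash property for a single ensemble. -/
def Ensemble.HashBound {α β : Type*} [Fintype α] [DecidableEq α] [DecidableEq β]
    (E : Ensemble α β) (a b : ℝ) : Prop :=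
  ∀ T T' : Finset α, ∑ u ∈ T, ∑ u' ∈ T', E.collisionProb u u' ≤
    ((T ∩ T').card : ℝ) + (T.card : ℝ) * (T'.card : ℝ) * a / (E.im.card : ℝ)
      + (min T.card T'.card : ℕ) * b

theorem Ensemble.sum_prob_collision {α β : Type*} [DecidableEq β] {E : Ensemble α β}
    (T T' : Finset α) :
    ∑ A ∈ E.fns, E.prob A * ∑ u ∈ T, ∑ u' ∈ T', (if A u = A u' then (1 : ℝ) else 0) =
      ∑ u ∈ T, ∑ u' ∈ T', E.collisionProb u u' := by
  simp only [mul_sum]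
  rw [sum_comm]
  refine sum_congr rfl fun u _ => ?_
  rw [sum_comm]
  refine sum_congr rfl fun u' _ => ?_
  simp [Ensemble.collisionProb, sum_filter]

section Ensemble

variable {α β : Type*} [Fintype α] [DecidableEq β] {E : Ensemble α β}

theorem Ensemble.apply_mem_im {A : α → β} (hA : A ∈ E.fns) (u : α) : A u ∈ E.im :=
  mem_biUnion.2 ⟨A, hA, mem_image_of_mem _ (mem_univ u)⟩

theorem Ensemble.im_card_pos [Nonempty α] : 0 < E.im.card := by
  have : E.fns.Nonempty := by
    rw [nonempty_iff_ne_empty]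
    intro h
    have := E.sum_prob
    simp [h] at this
  obtain ⟨A, hA⟩ := this
  exact card_pos.2 ⟨_, E.apply_mem_im hA (Classical.arbitrary α)⟩

/-- Second-moment bound on the number of cosets that miss `T`. -/
theorem Ensemble.card_unhit_mul_le [DecidableEq α] {A : α → β} (hA : A ∈ E.fns) (T : Finset α)
    (him : 0 < E.im.card) :
    ((E.im.filter fun c => ∀ u ∈ T, A u ≠ c).card : ℝ) * ((T.card : ℝ) / E.im.card) ^ 2 ≤
      ∑ u ∈ T, ∑ u' ∈ T, (if A u = A u' then (1 : ℝ) else 0) - (T.card : ℝ) ^ 2 / E.im.card := by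
  set M : ℝ := (E.im.card : ℝ) with hM
  have hMpos : 0 < M := Nat.cast_pos.2 him
  set N : β → ℝ := fun c => ∑ u ∈ T, if A u = c then (1 : ℝ) else 0 with hN
  have h1 : ∑ c ∈ E.im, N c = T.card := by
    rw [hN, sum_comm]
    simp [E.apply_mem_im hA]
  have h2 : ∑ c ∈ E.im, N c ^ 2 = ∑ u ∈ T, ∑ u' ∈ T, (if A u = A u' then (1 : ℝ) else 0) := by
    simp only [hN, sq, sum_mul_sum]
    rw [sum_comm]
    refine sum_congr rfl fun u _ => ?_
    rw [sum_comm]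
    refine sum_congr rfl fun u' _ => ?_
    simp [E.apply_mem_im hA, eq_comm]
  -- Chebyshev: `N` counts the points of `T` in each coset and has mean `|T| / M` over the image. A
  -- missed coset deviates by exactly this mean.
  have h3 : ∑ c ∈ E.im, (N c - T.card / M) ^ 2 = ∑ c ∈ E.im, N c ^ 2 - (T.card : ℝ) ^ 2 / M := by
    have : ∀ c, (N c - T.card / M) ^ 2 = N c ^ 2 - (2 * T.card / M) * N c + (T.card / M) ^ 2 :=
      fun c => by ring
    simp only [this, sum_add_distrib, sum_sub_distrib, ← mul_sum, h1, sum_const, nsmul_eq_mul,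
      ← hM]
    field_simp
    ring
  rw [← h2, ← h3, ← nsmul_eq_mul, ← sum_const]
  calc ∑ c ∈ E.im.filter (fun c => ∀ u ∈ T, A u ≠ c), ((T.card : ℝ) / M) ^ 2
      = ∑ c ∈ E.im.filter (fun c => ∀ u ∈ T, A u ≠ c), (N c - T.card / M) ^ 2 := by
        refine sum_congr rfl fun c hc => ?_
        have : N c = 0 := sum_eq_zero fun u hu => if_neg ((mem_filter.1 hc).2 u hu)
        rw [this]; ring
    _ ≤ _ := sum_le_sum_of_subset_of_nonneg (filter_subset _ _) fun _ _ _ => sq_nonneg _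

/-- Saturation: a random coset meets every large set with high probability. -/
theorem Ensemble.HashBound.saturation [DecidableEq α] {a b : ℝ} (h : E.HashBound a b) (T : Finset α)
    (hT : 0 < T.card) (him : 0 < E.im.card) :
    ∑ A ∈ E.fns, E.prob A * ((E.im.filter fun c => ∀ u ∈ T, A u ≠ c).card : ℝ) ≤
      E.im.card * (E.im.card * (1 + b) / T.card + a - 1) := by
  set M : ℝ := (E.im.card : ℝ) with hM
  have hMpos : 0 < M := Nat.cast_pos.2 him
  set t : ℝ := (T.card : ℝ) with ht
  have htpos : 0 < t := Nat.cast_pos.2 hT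
  have h1 : (∑ A ∈ E.fns, E.prob A * ((E.im.filter fun c => ∀ u ∈ T, A u ≠ c).card : ℝ))
      * (t / M) ^ 2 ≤ ∑ u ∈ T, ∑ u' ∈ T, E.collisionProb u u' - t ^ 2 / M := by
    have h0 : t ^ 2 / M = ∑ A ∈ E.fns, E.prob A * (t ^ 2 / M) := by
      rw [← sum_mul, E.sum_prob, one_mul]
    rw [sum_mul, ← E.sum_prob_collision, h0, ← sum_sub_distrib]
    refine sum_le_sum fun A hA => ?_
    rw [mul_assoc, ← mul_sub]
    exact mul_le_mul_of_nonneg_left (E.card_unhit_mul_le hA T him) (E.prob_nonneg A hA)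
  have h2 := h T T
  rw [inter_self, min_self] at h2
  have h3 := h1.trans (sub_le_sub_right h2 _)
  have hp : 0 < (t / M) ^ 2 := by positivity
  rw [← mul_le_mul_iff_left₀ hp]
  refine h3.trans (le_of_eq ?_)
  rw [← ht, ← hM]
  field_simp
  ring

/-- A union bound over `T`, then the hash property for the pair `{u}`, `T`. The intersection term
vanishes since `u ∉ T`; the absolute value is there because `b` may be negative. -/
theorem Ensemble.HashBound.collision [DecidableEq α] {a b : ℝ} (h : E.HashBound a b) (u : α)
    (T : Finset α)
    (hu : u ∉ T) :
    ∑ A ∈ E.fns with ∃ u' ∈ T, A u = A u', E.prob A ≤ T.card * a / E.im.card + |b| := by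
  have h1 : ∑ A ∈ E.fns with ∃ u' ∈ T, A u = A u', E.prob A ≤
      ∑ u₀ ∈ {u}, ∑ u' ∈ T, E.collisionProb u₀ u' := by
    rw [← E.sum_prob_collision, sum_filter]
    refine sum_le_sum fun A hA => ?_
    have hp := E.prob_nonneg A hA
    have hnn : ∀ u' ∈ T, (0 : ℝ) ≤ if A u = A u' then 1 else 0 := fun u' _ => by
      split_ifs <;> norm_num
    rw [sum_singleton]
    split_ifs with hex
    · obtain ⟨u', hu', he⟩ := hex
      have := single_le_sum hnn hu'
      rw [if_pos he] at this
      nlinarith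
    · exact mul_nonneg hp (sum_nonneg hnn)
  refine h1.trans ((h {u} T).trans ?_)
  rw [singleton_inter_of_notMem hu]
  have hb : ((min (card {u}) T.card : ℕ) : ℝ) * b ≤ |b| := by
    have h0 : ((min (card {u}) T.card : ℕ) : ℝ) ≤ 1 := by
      rw [card_singleton]; exact_mod_cast min_le_left _ _
    calc _ ≤ ((min (card {u}) T.card : ℕ) : ℝ) * |b| :=
          mul_le_mul_of_nonneg_left (le_abs_self b) (Nat.cast_nonneg _)
      _ ≤ 1 * |b| := mul_le_mul_of_nonneg_right h0 (abs_nonneg b)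
      _ = |b| := one_mul _
  simp only [card_empty, Nat.cast_zero, card_singleton, Nat.cast_one, one_mul, zero_add] at hb ⊢
  linarith

end Ensemble

theorem card_mul_le_of_sum_le_one {α : Type*} {s : Finset α} {q : α → ℝ} {θ : ℝ} [Fintype α]
    (hq : ∀ u, 0 ≤ q u) (h1 : ∑ u, q u ≤ 1) (hs : ∀ u ∈ s, θ ≤ q u) : (s.card : ℝ) * θ ≤ 1 := by
  rw [← nsmul_eq_mul, ← sum_const]
  exact (sum_le_sum hs).trans
    ((sum_le_sum_of_subset_of_nonneg (subset_univ s) fun u _ _ => hq u).trans h1)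

/-! ### Moment generating functions -/

/-- For `x ≤ 0` invert the quadratic lower bound of `exp (-x)`, using `(1 + x + x²/2)(1 - x + x²/2)
= 1 + x⁴/4 ≥ 1`. For `x ≥ 0` the difference of the two sides is monotone, since `exp (-y) ≥ 1 - y`.
-/
theorem exp_le_one_add_add_sq (x : ℝ) :
    Real.exp x ≤ 1 + x + x ^ 2 / 2 * max 1 (Real.exp x) := by
  rcases le_total x 0 with hx | hx
  · rw [max_eq_left (Real.exp_le_one_iff.2 hx), mul_one]
    have h1 := Real.quadratic_le_exp_of_nonneg (neg_nonneg.2 hx)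
    have h2 : Real.exp x * Real.exp (-x) = 1 := by rw [← Real.exp_add]; simp
    have h3 : 0 < Real.exp x := Real.exp_pos x
    have h4 : Real.exp x * (1 + -x + (-x) ^ 2 / 2) ≤ 1 :=
      (mul_le_mul_of_nonneg_left h1 h3.le).trans h2.le
    have h5 : 0 < 1 + -x + (-x) ^ 2 / 2 := by nlinarith
    refine le_of_mul_le_mul_right (h4.trans ?_) h5
    nlinarith [sq_nonneg (x ^ 2)]
  · rw [max_eq_right (Real.one_le_exp_iff.2 hx)]
    have hd : ∀ y : ℝ, HasDerivAt (fun y => 1 + y + y ^ 2 / 2 * Real.exp y - Real.exp y)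
        (1 + (y * Real.exp y + y ^ 2 / 2 * Real.exp y) - Real.exp y) y := by
      intro y
      have h1 : HasDerivAt (fun y : ℝ => y ^ 2 / 2) y y := by
        have := (hasDerivAt_pow 2 y).div_const 2
        simpa using this
      exact (((hasDerivAt_id y).const_add 1).add (h1.mul (Real.hasDerivAt_exp y))).sub
        (Real.hasDerivAt_exp y)
    have hmono : MonotoneOn (fun y => 1 + y + y ^ 2 / 2 * Real.exp y - Real.exp y) (Set.Ici 0) := by
      refine monotoneOn_of_deriv_nonneg (convex_Ici 0)
        (fun y _ => (hd y).continuousAt.continuousWithinAt)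
        (fun y _ => (hd y).differentiableAt.differentiableWithinAt) fun y hy => ?_
      rw [(hd y).deriv]
      have h1 := Real.add_one_le_exp (-y)
      have h2 : Real.exp y * Real.exp (-y) = 1 := by rw [← Real.exp_add]; simp
      have h3 : 0 < Real.exp y := Real.exp_pos y
      have h4 := mul_le_mul_of_nonneg_left h1 h3.le
      have : 0 ≤ y ^ 2 / 2 * Real.exp y := by positivity
      nlinarith
    have := hmono Set.self_mem_Ici (Set.mem_Ici.2 hx) hx
    simp only [Real.exp_zero] at this
    linarith

/-- Controls the quadratic remainder where `g` is unbounded below, by the quantity `exp (-g)` whose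
mean is at most 1. From `exp t ≥ e t` at `t = -g/3` one gets the constant `9 / e²`, and `9 / 7.2 =
5/4`. -/
theorem sq_mul_exp_le {g l : ℝ} (hg : g ≤ 0) (hl : l ≤ 1 / 3) :
    g ^ 2 * Real.exp (-(l * g)) ≤ 5 / 4 * Real.exp (-g) := by
  have h1 : g ^ 2 ≤ 5 / 4 * Real.exp (-(2 / 3 * g)) := by
    have h2 : -g / 3 * Real.exp 1 ≤ Real.exp (-g / 3) := by
      have := Real.add_one_le_exp (-g / 3 - 1)
      rw [sub_add_cancel, Real.exp_sub, le_div_iff₀ (Real.exp_pos 1)] at this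
      exact this
    have h3 : (-g / 3 * Real.exp 1) ^ 2 ≤ Real.exp (-g / 3) ^ 2 :=
      pow_le_pow_left₀ (mul_nonneg (by linarith) (Real.exp_pos 1).le) h2 2
    have h4 : Real.exp (-g / 3) ^ 2 = Real.exp (-(2 / 3 * g)) := by
      rw [← Real.exp_nat_mul]; congr 1; push_cast; ring
    have h5 := Real.exp_one_gt_d9
    have h6 : 7.2 ≤ Real.exp 1 ^ 2 := by nlinarith
    rw [h4] at h3
    nlinarith [sq_nonneg g]
  calc g ^ 2 * Real.exp (-(l * g)) ≤ 5 / 4 * Real.exp (-(2 / 3 * g)) * Real.exp (-(l * g)) :=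
        mul_le_mul_of_nonneg_right h1 (Real.exp_pos _).le
    _ = 5 / 4 * Real.exp (-(2 / 3 * g) + -(l * g)) := by rw [Real.exp_add]; ring
    _ ≤ 5 / 4 * Real.exp (-g) := by
        gcongr
        nlinarith

/-- Sub-Gaussian bound for the moment generating function of a log-likelihood. -/
theorem sum_mul_exp_le {ι : Type*} [Fintype ι] {P g : ι → ℝ} {κ l : ℝ} (hP : ∀ i, 0 ≤ P i)
    (hP1 : ∑ i, P i = 1) (hg : ∀ i, g i ≤ κ) (hPg : ∑ i, P i * Real.exp (-g i) ≤ 1)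
    (hl0 : 0 ≤ l) (hl : l ≤ 1 / 3) :
    ∑ i, P i * Real.exp (-(l * g i)) ≤
      Real.exp (-(l * ∑ i, P i * g i) + l ^ 2 / 2 * (κ ^ 2 + 5 / 4)) := by
  have hpt : ∀ i, P i * Real.exp (-(l * g i)) ≤
      P i - l * (P i * g i) + l ^ 2 / 2 * (κ ^ 2 * P i + 5 / 4 * (P i * Real.exp (-g i))) := by
    intro i
    have h1 := exp_le_one_add_add_sq (-(l * g i))
    have h2 : g i ^ 2 * max 1 (Real.exp (-(l * g i))) ≤ κ ^ 2 + 5 / 4 * Real.exp (-g i) := by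
      have he := Real.exp_pos (-g i)
      -- Where `g ≥ 0` the remainder is bounded by `κ²`; where `g ≤ 0` by the integrable `exp (-g)`.
      rcases le_total 0 (g i) with h0 | h0
      · rw [max_eq_left (Real.exp_le_one_iff.2 (by nlinarith))]
        nlinarith [hg i]
      · rw [max_eq_right (Real.one_le_exp_iff.2 (by nlinarith))]
        nlinarith [sq_mul_exp_le h0 hl, sq_nonneg κ]
    have h3 : Real.exp (-(l * g i)) ≤
        1 - l * g i + l ^ 2 / 2 * (κ ^ 2 + 5 / 4 * Real.exp (-g i)) := by
      have := mul_le_mul_of_nonneg_left h2 (show 0 ≤ l ^ 2 / 2 by positivity)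
      nlinarith
    have := mul_le_mul_of_nonneg_left h3 (hP i)
    nlinarith
  calc _ ≤ ∑ i, (P i - l * (P i * g i)
          + l ^ 2 / 2 * (κ ^ 2 * P i + 5 / 4 * (P i * Real.exp (-g i)))) :=
        sum_le_sum fun i _ => hpt i
    _ = 1 - l * ∑ i, P i * g i
          + l ^ 2 / 2 * (κ ^ 2 + 5 / 4 * ∑ i, P i * Real.exp (-g i)) := by
        simp only [sum_add_distrib, sum_sub_distrib, ← mul_sum, hP1, mul_one]
    _ ≤ (-(l * ∑ i, P i * g i) + l ^ 2 / 2 * (κ ^ 2 + 5 / 4)) + 1 := by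
        have := mul_le_mul_of_nonneg_left hPg (show 0 ≤ l ^ 2 / 2 * (5 / 4) by positivity)
        nlinarith
    _ ≤ _ := Real.add_one_le_exp _

/-! ### Estimates for ζ and large-deviation exponents -/

theorem logb_two_le_tangent {s t : ℝ} (hs : 0 < s) (m : ℕ) (ht : t = 2 ^ m) :
    Real.logb 2 s ≤ m + (s / t - 1) / Real.log 2 := by
  have hl : 0 < Real.log 2 := Real.log_pos one_lt_two
  have htp : 0 < t := by rw [ht]; positivity
  rw [Real.logb, ← sub_le_iff_le_add', div_sub' hl.ne', div_le_div_iff_of_pos_right hl]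
  have := Real.log_le_sub_one_of_pos (div_pos hs htp)
  rw [Real.log_div hs.ne' htp.ne', ht, Real.log_pow] at this
  rw [ht]
  linarith

theorem sqrt_two_mul_three_mul {ε s : ℝ} (hs : 0 ≤ s) (h : ε = s ^ 2 / 6) :
    √(2 * (3 * ε)) = s := by
  rw [h, show 2 * (3 * (s ^ 2 / 6)) = s ^ 2 by ring, Real.sqrt_sq hs]

theorem zetaFun_eq {K : ℕ} {ε s : ℝ} (hs : 0 < s) (h : ε = s ^ 2 / 6) (hK : 0 < K) :
    zetaFun K (3 * ε) = s ^ 2 / 2 + s * (Real.logb 2 K - Real.logb 2 s) := by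
  have hK' : (K : ℝ) ≠ 0 := by positivity
  rw [zetaFun, sqrt_two_mul_three_mul hs.le h, Real.logb_div hs.ne' hK', h]
  ring

theorem one_le_logb_two {K : ℕ} (hK : 2 ≤ K) : 1 ≤ Real.logb 2 K := by
  rw [Real.le_logb_iff_rpow_le one_lt_two (by positivity), Real.rpow_one]
  exact_mod_cast hK

/-- The regime of large `ε`, where plain Markov's inequality suffices in `exists_exponent`. Since `s
≥ 1`, the worst case is `log K = 1`, which leaves an inequality in `s` alone. -/
theorem logb_add_le_zetaFun {K : ℕ} {ε s : ℝ} (hs : 1 ≤ s) (h : ε = s ^ 2 / 6) (hK : 2 ≤ K) :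
    Real.logb 2 K + ε ≤ zetaFun K (3 * ε) := by
  have hs0 : 0 < s := by linarith
  rw [zetaFun_eq hs0 h (by omega), h]
  have hk := one_le_logb_two hK
  have hl1 := Real.log_two_gt_d9
  have hl2 := Real.log_two_lt_d9
  have hl : 0 < Real.log 2 := by linarith
  obtain ⟨c, hc⟩ : ∃ c, c = 1 / Real.log 2 := ⟨_, rfl⟩
  have hc1 : 1.4426 ≤ c := by rw [hc, le_div_iff₀ hl]; nlinarith
  have hc2 : c ≤ 1.4428 := by rw [hc, div_le_iff₀ hl]; nlinarith
  suffices hmain : 1 + s * Real.logb 2 s ≤ s + s ^ 2 / 3 by nlinarith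
  -- Tangents of the concave logarithm at 2, 4 and 16 serve the ranges `s ≤ 2.75`, `2.75 ≤ s ≤ 12`
  -- and `s ≥ 12`.
  have t (m : ℕ) : Real.logb 2 s ≤ m + (s / 2 ^ m - 1) * c := by
    have := logb_two_le_tangent hs0 m rfl
    rwa [div_eq_mul_one_div _ (Real.log 2), ← hc] at this
  have t1 := mul_le_mul_of_nonneg_left (t 1) hs0.le
  have t2 := mul_le_mul_of_nonneg_left (t 2) hs0.le
  have t4 := mul_le_mul_of_nonneg_left (t 4) hs0.le
  norm_num at t1 t2 t4
  rcases le_total s 2.75 with h1 | h1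
  · have : s * ((s / 2 - 1) * c) ≤ s * (1.4428 * s / 2 - 1.4426) := by
      refine mul_le_mul_of_nonneg_left ?_ hs0.le
      nlinarith
    nlinarith
  rcases le_total s 12 with h2 | h2
  · have : s * ((s / 4 - 1) * c) ≤ s * (1.4428 * s / 4 - 1.4426) := by
      refine mul_le_mul_of_nonneg_left ?_ hs0.le
      nlinarith
    nlinarith
  · have : s * ((s / 16 - 1) * c) ≤ s * (1.4428 * s / 16 - 1.4426) := by
      refine mul_le_mul_of_nonneg_left ?_ hs0.le
      nlinarith
    nlinarith

theorem zetaFun_nonneg {K : ℕ} {ε : ℝ} (hε : 0 < ε) (hK : 2 ≤ K) : 0 ≤ zetaFun K (3 * ε) := by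
  have hs : 0 < √(6 * ε) := Real.sqrt_pos.2 (by linarith)
  have h : ε = √(6 * ε) ^ 2 / 6 := by rw [Real.sq_sqrt (by linarith)]; ring
  rcases le_total 1 √(6 * ε) with h1 | h1
  · linarith [logb_add_le_zetaFun h1 h hK, one_le_logb_two hK]
  · rw [zetaFun_eq hs h (by omega)]
    have := Real.logb_nonpos one_lt_two hs.le h1
    have := one_le_logb_two hK
    have : 0 ≤ √(6 * ε) * (Real.logb 2 K - Real.logb 2 √(6 * ε)) :=
      mul_nonneg hs.le (by linarith)
    positivity

/-- Large deviations of the log-likelihood `f` above its mean by `ζ(3ε)` have exponent `ε`. -/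
theorem exists_exponent {ι : Type*} [Fintype ι] {P f : ι → ℝ} {k K : ℕ} {ε : ℝ} (hε : 0 < ε)
    (hk : 2 ≤ k) (hkK : k ≤ K) (hP : ∀ i, 0 ≤ P i) (hP1 : ∑ i, P i = 1) (hf : ∀ i, 0 ≤ f i)
    (hPf : ∑ i, P i * (2 : ℝ) ^ f i ≤ k) :
    ∃ l > 0, ∑ i, P i * (2 : ℝ) ^ (l * (f i - (∑ j, P j * f j) - zetaFun K (3 * ε))) ≤
      (2 : ℝ) ^ (-ε) := by
  have hs : 0 < √(6 * ε) := Real.sqrt_pos.2 (by linarith)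
  have h : ε = √(6 * ε) ^ 2 / 6 := by rw [Real.sq_sqrt (by linarith)]; ring
  generalize √(6 * ε) = s at hs h
  set m := ∑ j, P j * f j with hm
  have hm0 : 0 ≤ m := sum_nonneg fun i _ => mul_nonneg (hP i) (hf i)
  have hkpos : (0 : ℝ) < k := by positivity
  have hKpos : (0 : ℝ) < K := by exact_mod_cast (by omega : 0 < K)
  have hkK' : (k : ℝ) ≤ K := by exact_mod_cast hkK
  set ζ := zetaFun K (3 * ε) with hζ
  rcases le_total 1 s with h1 | h1
  -- For `s ≥ 1` take `l = 1`: the exponential moment is at most `K`, and the mean `m`, being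
  -- nonnegative, only helps.
  · refine ⟨1, one_pos, ?_⟩
    have hz := logb_add_le_zetaFun h1 h (hk.trans hkK)
    calc ∑ i, P i * (2 : ℝ) ^ (1 * (f i - m - ζ))
        = (∑ i, P i * (2 : ℝ) ^ f i) * (2 : ℝ) ^ (-m - ζ) := by
          rw [sum_mul]
          refine sum_congr rfl fun i _ => ?_
          rw [mul_assoc, ← Real.rpow_add two_pos]; congr 2; ring
      _ ≤ K * (2 : ℝ) ^ (-m - ζ) :=
          mul_le_mul_of_nonneg_right (hPf.trans hkK') (by positivity)
      _ = (2 : ℝ) ^ (Real.logb 2 K + (-m - ζ)) := by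
          rw [Real.rpow_add two_pos, Real.rpow_logb two_pos (by norm_num) hKpos]
      _ ≤ (2 : ℝ) ^ (-ε) := Real.rpow_le_rpow_of_exponent_le one_le_two (by linarith)
  · set L := Real.log K - Real.log s with hL
    have hl1 := Real.log_two_gt_d9
    have hl2 := Real.log_two_lt_d9
    have hl : 0 < Real.log 2 := by linarith
    have hlogk : Real.log 2 ≤ Real.log k := Real.log_le_log two_pos (by exact_mod_cast hk)
    have hkL : Real.log k ≤ L := by
      have := Real.log_nonpos hs.le h1
      have := Real.log_le_log hkpos hkK'
      linarith
    have hLpos : 0 < L := by linarith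
    -- The optimum over `l` is of order `s / L`; the factor 5 makes both `l ≤ 1/3` and the final
    -- inequality in `key` hold.
    set l := s / (5 * L) with hldef
    have hlpos : 0 < l := by positivity
    have hl3 : l ≤ 1 / 3 := by
      rw [hldef, div_le_div_iff₀ (by positivity) (by norm_num)]
      nlinarith
    refine ⟨l, hlpos, ?_⟩
    -- In nats, and shifted by `log k`, so that `∑ P exp (-g) ≤ 1` and `g ≤ log k`.
    set g : ι → ℝ := fun i => Real.log k - f i * Real.log 2 with hg
    have hmain := sum_mul_exp_le (P := P) (g := g) (κ := Real.log k) (l := l) hP hP1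
      (fun i => by have := mul_nonneg (hf i) hl.le; simp only [hg]; linarith)
      (by
        have : ∀ i, P i * Real.exp (-g i) = P i * (2 : ℝ) ^ f i / k := fun i => by
          rw [hg, neg_sub, Real.exp_sub, Real.exp_log hkpos, Real.rpow_def_of_pos two_pos,
            mul_comm (f i)]
          ring
        simp only [this, ← sum_div]
        rw [div_le_one hkpos]; exact hPf) hlpos.le hl3
    have hEg : ∑ i, P i * g i = Real.log k - m * Real.log 2 := by
      simp only [hg, mul_sub, sum_sub_distrib, ← sum_mul, hP1, one_mul, hm, ← mul_assoc]
    rw [hEg] at hmain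
    have hz : ζ * Real.log 2 = s ^ 2 / 2 * Real.log 2 + s * L := by
      rw [hζ, zetaFun_eq hs h (by omega), hL, Real.logb, Real.logb]
      field_simp
    -- As `L ≥ log 2`, `5/4 ≤ 3 L²`. With `l L = s / 5` the claim becomes `2/25 + (log 2) / 6 ≤
    -- 1/5`, which holds narrowly. The summand `s²/2` of ζ is not needed.
    have key : l ^ 2 / 2 * (Real.log k ^ 2 + 5 / 4) + ε * Real.log 2 ≤ l * (s * L) := by
      have hM : Real.log k ^ 2 + 5 / 4 ≤ 4 * L ^ 2 := by nlinarith
      have h2 : l ^ 2 / 2 * (Real.log k ^ 2 + 5 / 4) ≤ l ^ 2 / 2 * (4 * L ^ 2) :=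
        mul_le_mul_of_nonneg_left hM (by positivity)
      have hlL : l * L = s / 5 := by rw [hldef]; field_simp
      have h3 : l ^ 2 / 2 * (4 * L ^ 2) = 2 * s ^ 2 / 25 := by
        rw [show l ^ 2 / 2 * (4 * L ^ 2) = 2 * (l * L) ^ 2 by ring, hlL]; ring
      have h4 : l * (s * L) = s ^ 2 / 5 := by
        rw [show l * (s * L) = s * (l * L) by ring, hlL]; ring
      rw [h4, h]
      nlinarith [sq_nonneg s]
    have hterm : ∀ i, P i * (2 : ℝ) ^ (l * (f i - m - ζ)) =
        P i * Real.exp (-(l * g i))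
          * Real.exp (l * (Real.log k - m * Real.log 2) - l * (ζ * Real.log 2)) := fun i => by
      rw [mul_assoc, ← Real.exp_add, Real.rpow_def_of_pos two_pos]
      congr 2
      simp only [hg]; ring
    simp only [hterm, ← sum_mul]
    refine (mul_le_mul_of_nonneg_right hmain (Real.exp_pos _).le).trans ?_
    rw [← Real.exp_add, Real.rpow_def_of_pos two_pos, Real.exp_le_exp, hz]
    have : 0 ≤ l * (s ^ 2 / 2 * Real.log 2) := by positivity
    linarith

/-- Exponential moments beat any level above the mean. -/
theorem exists_sum_mul_rpow_lt_one {ι : Type*} [Fintype ι] {P f : ι → ℝ} {a : ℝ}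
    (hP1 : ∑ i, P i = 1) (ha : ∑ i, P i * f i < a) :
    ∃ l > 0, ∑ i, P i * (2 : ℝ) ^ (l * (f i - a)) < 1 := by
  -- The sum equals 1 at `l = 0` and its derivative there is `log 2` times mean minus `a`, which is
  -- negative.
  have hd : HasDerivAt (fun l : ℝ => ∑ i, P i * (2 : ℝ) ^ (l * (f i - a)))
      (∑ i, P i * (Real.log 2 * (f i - a) * (2 : ℝ) ^ ((0 : ℝ) * (f i - a)))) 0 := by
    refine HasDerivAt.fun_sum fun i _ => HasDerivAt.const_mul _ ?_
    have h1 : HasDerivAt (fun l : ℝ => l * (f i - a)) (f i - a) 0 := by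
      simpa using (hasDerivAt_id (0 : ℝ)).mul_const (f i - a)
    exact h1.const_rpow two_pos
  have hneg : ∑ i, P i * (Real.log 2 * (f i - a) * (2 : ℝ) ^ ((0 : ℝ) * (f i - a))) < 0 := by
    have : ∀ i, P i * (Real.log 2 * (f i - a) * (2 : ℝ) ^ ((0 : ℝ) * (f i - a))) =
        Real.log 2 * (P i * f i - P i * a) := fun i => by
      rw [zero_mul, Real.rpow_zero]; ring
    simp only [this, ← mul_sum, sum_sub_distrib, ← sum_mul, hP1, one_mul]
    exact mul_neg_of_pos_of_neg (Real.log_pos one_lt_two) (by linarith)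
  have hs := (hasDerivAt_iff_tendsto_slope.1 hd).eventually (gt_mem_nhds hneg)
  have hs' := hs.filter_mono (nhdsWithin_mono 0 (fun x (hx : 0 < x) => hx.ne') : 𝓝[>] (0:ℝ) ≤ _)
  obtain ⟨l, hl, hl0⟩ := (hs'.and self_mem_nhdsWithin).exists
  have hl0 : 0 < l := hl0
  refine ⟨l, hl0, ?_⟩
  rw [slope_def_field, sub_zero, div_lt_iff₀ hl0, zero_mul, sub_neg] at hl
  simpa [hP1] using hl

/-! ### One-shot coding -/

section OneShot

variable {α γ CA CB CX : Type*} [Fintype α] [Fintype γ]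
  [DecidableEq α] [DecidableEq CA] [DecidableEq CB] [DecidableEq CX]

open Classical in
/-- The average number of cosets containing no `z` with `v z ≥ θ₁`. -/
theorem sum_unhit_le [DecidableEq γ] {E : Ensemble γ CA} {a b : ℝ} (h : E.HashBound a b)
    (hb : 0 ≤ 1 + b)
    (him : 0 < E.im.card) {v : γ → ℝ} (hv : ∀ z, 0 ≤ v z) (hv1 : ∑ z, v z = 1) {θ₀ θ₁ : ℝ}
    (hθ₀ : 0 < θ₀) :
    ∑ A ∈ E.fns, E.prob A * ((E.im.filter fun c => ∀ z, θ₁ ≤ v z → A z ≠ c).card : ℝ) ≤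
      E.im.card * (2 * ∑ z with v z < θ₁ ∨ θ₀ < v z, v z
        + (E.im.card * (1 + b) * (2 * θ₀) + |a - 1|)) := by
  have hM : (0 : ℝ) < E.im.card := Nat.cast_pos.2 him
  have hs0 : 0 ≤ ∑ z with v z < θ₁ ∨ θ₀ < v z, v z := sum_nonneg fun z _ => hv z
  have hC : 0 ≤ E.im.card * (1 + b) * (2 * θ₀) + |a - 1| := by positivity
  set T : Finset γ := univ.filter fun z => θ₁ ≤ v z with hT
  -- If the atypical mass is at least 1/2, twice it already exceeds the trivial bound 1. Otherwise
  -- the typical points have mass at least 1/2 and each weighs at most `θ₀`, so `T` has at least `1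
  -- / (2 θ₀)` points.
  rcases le_or_gt (1 / 2) (∑ z with v z < θ₁ ∨ θ₀ < v z, v z) with hat | hat
  · calc ∑ A ∈ E.fns, E.prob A * ((E.im.filter fun c => ∀ z, θ₁ ≤ v z → A z ≠ c).card : ℝ)
        ≤ ∑ A ∈ E.fns, E.prob A * (E.im.card : ℝ) :=
          sum_le_sum fun A hA => mul_le_mul_of_nonneg_left
            (by exact_mod_cast card_le_card (filter_subset _ _)) (E.prob_nonneg A hA)
      _ = E.im.card * 1 := by rw [← sum_mul, E.sum_prob]; ring
      _ ≤ _ := mul_le_mul_of_nonneg_left (by linarith) hM.le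
  · have hcard : 1 / 2 ≤ (T.card : ℝ) * θ₀ := by
      have h1 : ∑ z with ¬ (v z < θ₁ ∨ θ₀ < v z), v z ≤ (T.card : ℝ) * θ₀ := by
        rw [← nsmul_eq_mul, ← sum_const]
        calc _ ≤ ∑ z with ¬ (v z < θ₁ ∨ θ₀ < v z), θ₀ := sum_le_sum fun z hz => by
                have := (mem_filter.1 hz).2
                push Not at this
                exact this.2
          _ ≤ _ := sum_le_sum_of_subset_of_nonneg (fun z hz => by
                have := (mem_filter.1 hz).2
                push Not at this
                exact mem_filter.2 ⟨mem_univ _, this.1⟩) fun _ _ _ => hθ₀.le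
      have h2 := sum_filter_add_sum_filter_not univ (fun z => v z < θ₁ ∨ θ₀ < v z) v
      linarith
    have hTpos : (0 : ℝ) < T.card := by
      by_contra hn
      have := mul_nonpos_of_nonpos_of_nonneg (not_lt.1 hn) hθ₀.le
      linarith
    have hsat := h.saturation T (Nat.cast_pos.1 hTpos) him
    have heq : ∀ A : γ → CA, (E.im.filter fun c => ∀ z, θ₁ ≤ v z → A z ≠ c) =
        E.im.filter fun c => ∀ z ∈ T, A z ≠ c := fun A => by
      refine filter_congr fun c _ => ?_
      simp [hT]
    simp only [heq]
    refine hsat.trans (mul_le_mul_of_nonneg_left ?_ hM.le)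
    have h3 : E.im.card * (1 + b) / T.card ≤ E.im.card * (1 + b) * (2 * θ₀) := by
      rw [div_le_iff₀ hTpos, mul_assoc]
      exact le_mul_of_one_le_right (by positivity) (by linarith)
    have := le_abs_self (a - 1)
    linarith

/-- Change of measure: the selected `z` costs a factor `1 / θ₁` per coset. -/
theorem sum_selected_le {s : Finset CA} {A : γ → CA} {v : γ → ℝ} (hv : ∀ z, 0 ≤ v z) {θ : ℝ}
    (hθ : 0 < θ) (g : CA → γ) (bad : γ → Prop) [DecidablePred bad] :
    ((s.filter fun c => (A (g c) = c ∧ θ ≤ v (g c)) ∧ bad (g c)).card : ℝ) ≤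
      1 / θ * ∑ z with bad z, v z := by
  rw [one_div, ← div_eq_inv_mul, le_div_iff₀ hθ]
  -- The selection is injective: `c` is recovered as `A (g c)`.
  have h1 : (s.filter fun c => (A (g c) = c ∧ θ ≤ v (g c)) ∧ bad (g c)).card ≤
      (univ.filter fun z => θ ≤ v z ∧ bad z).card := by
    refine card_le_card_of_injOn g (fun c hc => ?_) fun c hc c' hc' h => ?_
    · have := (mem_filter.1 hc).2
      exact mem_filter.2 ⟨mem_univ _, this.1.2, this.2⟩
    · rw [← (mem_filter.1 hc).2.1.1, ← (mem_filter.1 hc').2.1.1, h]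
  calc _ ≤ ((univ.filter fun z => θ ≤ v z ∧ bad z).card : ℝ) * θ :=
        mul_le_mul_of_nonneg_right (by exact_mod_cast h1) hθ.le
    _ = ∑ z with θ ≤ v z ∧ bad z, θ := by rw [sum_const, nsmul_eq_mul]
    _ ≤ ∑ z with θ ≤ v z ∧ bad z, v z := sum_le_sum fun z hz => (mem_filter.1 hz).2.1
    _ ≤ _ := sum_le_sum_of_subset_of_nonneg (fun z hz =>
        mem_filter.2 ⟨mem_univ _, (mem_filter.1 hz).2.2⟩) fun z _ _ => hv z

open Classical in
/-- Decoding `z` from its hash value restricted to a coset fails rarely on average. -/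
theorem sum_decode_le [DecidableEq γ] {EA : Ensemble γ CA} {EB : Ensemble γ CB} {a b : ℝ}
    (h : EB.HashBound a b)
    (ha : 0 ≤ a) {A : γ → CA} (hA : A ∈ EA.fns) {Q : γ → ℝ}
    (hQ : ∀ z, 0 ≤ Q z) (hQ1 : ∑ z, Q z ≤ 1) {θ : ℝ} (hθ : 0 < θ)
    {gAB : (γ → CB) → CA → CB → γ}
    (hgAB : ∀ B c b, IsArgmax (cosetPair A B c b) Q (gAB B c b)) (g : CA → γ) :
    ∑ c ∈ EA.im, ∑ B ∈ EB.fns with (A (g c) = c ∧ θ ≤ Q (g c)) ∧ gAB B c (B (g c)) ≠ g c,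
        EB.prob B ≤
      a / (θ * EB.im.card) + EA.im.card * |b| := by
  set G : Finset γ := univ.filter fun z => θ ≤ Q z with hG
  have hGc : (G.card : ℝ) ≤ 1 / θ := by
    rw [le_div_iff₀ hθ]
    exact card_mul_le_of_sum_le_one hQ hQ1 fun z hz => (mem_filter.1 hz).2
  have hc : ∀ c ∈ EA.im,
      ∑ B ∈ EB.fns with (A (g c) = c ∧ θ ≤ Q (g c)) ∧ gAB B c (B (g c)) ≠ g c, EB.prob B ≤
        ((G.filter fun z => A z = c).card : ℝ) * a / EB.im.card + |b| := by
    intro c _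
    have hcol := h.collision (g c) ((G.filter fun z => A z = c).erase (g c)) (notMem_erase _ _)
    refine le_trans (sum_le_sum_of_subset_of_nonneg (fun B hB => ?_)
      fun B hB _ => EB.prob_nonneg B (mem_filter.1 hB).1) (hcol.trans ?_)
    -- A wrong decoder output is at least as likely as `g c`, so it lies in `G` and in the same
    -- coset of `A`, and it collides with `g c` under `B`.
    · obtain ⟨hBf, ⟨hgc, hQg⟩, hne⟩ := mem_filter.1 hB
      have hmem : g c ∈ cosetPair A B c (B (g c)) := ⟨hgc, rfl⟩
      obtain ⟨⟨h1, h2⟩, h3⟩ := hgAB B c (B (g c)) ⟨_, hmem⟩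
      refine mem_filter.2 ⟨hBf, gAB B c (B (g c)), mem_erase.2 ⟨hne, mem_filter.2
        ⟨mem_filter.2 ⟨mem_univ _, hQg.trans (h3 hmem)⟩, h1⟩⟩, h2.symm⟩
    · gcongr
      exact erase_subset _ _
  refine (sum_le_sum hc).trans ?_
  rw [sum_add_distrib, sum_const, nsmul_eq_mul, ← sum_div, ← sum_mul]
  -- The cosets of `A` partition `G`, so the sum over `c` costs no factor `M`. Averaging over `c`
  -- later gains `1 / M`, and no joint hash property of the pair is needed.
  have hfib : ∑ c ∈ EA.im, ((G.filter fun z => A z = c).card : ℝ) = G.card := by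
    exact_mod_cast (card_eq_sum_card_fiberwise fun z _ => EA.apply_mem_im hA z).symm
  rw [hfib]
  have : G.card * a / EB.im.card ≤ 1 / θ * a / EB.im.card := by gcongr
  have h2 : 1 / θ * a / EB.im.card = a / (θ * EB.im.card) := by field_simp
  linarith

open Classical in
/-- Decoding `x` from its hash value with side information fails rarely on average. -/
theorem sum_decode_side_le {E : Ensemble α CX} {a b : ℝ} (h : E.HashBound a b)
    (ha : 0 ≤ a) {r : α → ℝ} (hr : ∀ x, 0 ≤ r x) (hr1 : ∑ x, r x ≤ 1) {θ : ℝ} (hθ : 0 < θ)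
    {g : (α → CX) → CX → α} (hg : ∀ B b, IsArgmax (coset B b) r (g B b)) (x : α) :
    ∑ B ∈ E.fns with θ ≤ r x ∧ g B (B x) ≠ x, E.prob B ≤ a / (θ * E.im.card) + |b| := by
  set G : Finset α := univ.filter fun x => θ ≤ r x with hG
  have hGc : (G.card : ℝ) ≤ 1 / θ := by
    rw [le_div_iff₀ hθ]
    exact card_mul_le_of_sum_le_one hr hr1 fun z hz => (mem_filter.1 hz).2
  have hcol := h.collision x (G.erase x) (notMem_erase _ _)
  refine le_trans (sum_le_sum_of_subset_of_nonneg (fun B hB => ?_)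
      fun B hB _ => E.prob_nonneg B (mem_filter.1 hB).1) (hcol.trans ?_)
  · obtain ⟨hBf, hrx, hne⟩ := mem_filter.1 hB
    have hmem : x ∈ coset B (B x) := rfl
    obtain ⟨h1, h3⟩ := hg B (B x) ⟨_, hmem⟩
    exact mem_filter.2 ⟨hBf, g B (B x), mem_erase.2 ⟨hne,
      mem_filter.2 ⟨mem_univ _, hrx.trans (h3 hmem)⟩⟩, (show B (g B (B x)) = B x from h1).symm⟩
  · have h1 : ((G.erase x).card : ℝ) ≤ 1 / θ :=
      le_trans (by exact_mod_cast card_le_card (erase_subset _ _)) hGc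
    have : (G.erase x).card * a / E.im.card ≤ 1 / θ * a / E.im.card := by gcongr
    have h2 : 1 / θ * a / E.im.card = a / (θ * E.im.card) := by field_simp
    linarith

end OneShot

theorem ite_le_add_of_imp {e q₁ q₂ q₃ q₄ : Prop} [Decidable e] [Decidable q₁] [Decidable q₂]
    [Decidable q₃] [Decidable q₄] (h : e → q₁ ∨ q₂ ∨ q₃ ∨ q₄) :
    (if e then 1 else 0 : ℝ) ≤ (if q₁ then 1 else 0) + (if q₂ then 1 else 0)
      + (if q₃ then 1 else 0) + (if q₄ then 1 else 0) := by
  by_cases he : e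
  · rcases h he with h | h | h | h <;> rw [if_pos he, if_pos h] <;> split_ifs <;> norm_num
  · rw [if_neg he]
    split_ifs <;> norm_num

open Classical in
/-- One-shot coding theorem for the source `p.1` with the helper observing `p.2`. -/
theorem exists_code {α β γ CA CB CX : Type*} [Fintype α] [Fintype β] [Fintype γ] [Nonempty γ]
    [DecidableEq α] [DecidableEq γ] [DecidableEq CA] [DecidableEq CB] [DecidableEq CX]
    {EA : Ensemble γ CA} {EB : Ensemble γ CB} {EX : Ensemble α CX} {aA bA aB bB aX bX : ℝ}
    (hA : EA.HashBound aA bA) (hB : EB.HashBound aB bB) (hX : EX.HashBound aX bX)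
    (hbA : 0 ≤ 1 + bA) (haB : 0 ≤ aB) (haX : 0 ≤ aX)
    {P : α × β → ℝ} {V : β → γ → ℝ} {Q : γ → ℝ} {R : γ → α → ℝ}
    (hP : ∀ p, 0 ≤ P p) (hP1 : ∑ p, P p = 1)
    (hV : ∀ y z, 0 ≤ V y z) (hV1 : ∀ y, ∑ z, V y z = 1)
    (hQ : ∀ z, 0 ≤ Q z) (hQ1 : ∑ z, Q z ≤ 1)
    (hR : ∀ z x, 0 ≤ R z x) (hR1 : ∀ z, ∑ x, R z x ≤ 1)
    {θ₀ θ₁ θ₂ θ₃ : ℝ} (hθ₀ : 0 < θ₀) (hθ₁ : 0 < θ₁) (hθ₂ : 0 < θ₂) (hθ₃ : 0 < θ₃)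
    {gA : (γ → CA) → CA → β → γ} {gAB : (γ → CA) → (γ → CB) → CA → CB → γ}
    {gX : (α → CX) → CX → γ → α}
    (hgA : ∀ A c y, IsArgmax (coset A c) (V y) (gA A c y))
    (hgAB : ∀ A B c b, IsArgmax (cosetPair A B c b) Q (gAB A B c b))
    (hgX : ∀ B b z, IsArgmax (coset B b) (R z) (gX B b z)) :
    ∃ A ∈ EA.fns, ∃ B ∈ EB.fns, ∃ Bh ∈ EX.fns, ∃ c ∈ EA.im,
      ∑ p : α × β with gX Bh (Bh p.1) (gAB A B c (B (gA A c p.2))) ≠ p.1, P p ≤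
        (2 * ∑ p, P p * ∑ z with V p.2 z < θ₁ ∨ θ₀ < V p.2 z, V p.2 z
          + (EA.im.card * (1 + bA) * (2 * θ₀) + |aA - 1|))
        + 1 / (θ₁ * EA.im.card) * ∑ p, P p * ∑ z with Q z < θ₂ ∨ R z p.1 < θ₃, V p.2 z
        + (aB / (θ₂ * EB.im.card * EA.im.card) + |bB|)
        + (aX / (θ₃ * EX.im.card) + |bX|) := by
  have him : 0 < EA.im.card := EA.im_card_pos
  have hM : (0 : ℝ) < EA.im.card := Nat.cast_pos.2 him
  set M : ℝ := (EA.im.card : ℝ) with hMdef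
  -- The four error events: missed coset, bad selection, failure of `B`, failure of `Bh`. The third
  -- does not involve `Bh`, nor the fourth `B`.
  set t1 : (γ → CA) → CA → ℝ := fun A c =>
    ∑ p, P p * if ∀ z, θ₁ ≤ V p.2 z → A z ≠ c then 1 else 0 with ht1
  set t2 : (γ → CA) → CA → ℝ := fun A c =>
    ∑ p, P p * if (A (gA A c p.2) = c ∧ θ₁ ≤ V p.2 (gA A c p.2)) ∧
      (Q (gA A c p.2) < θ₂ ∨ R (gA A c p.2) p.1 < θ₃) then 1 else 0 with ht2
  set t3 : (γ → CA) → CA → (γ → CB) → ℝ := fun A c B =>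
    ∑ p, P p * if (A (gA A c p.2) = c ∧ θ₂ ≤ Q (gA A c p.2)) ∧
      gAB A B c (B (gA A c p.2)) ≠ gA A c p.2 then 1 else 0 with ht3
  set t4 : (γ → CA) → CA → (α → CX) → ℝ := fun A c Bh =>
    ∑ p, P p * if θ₃ ≤ R (gA A c p.2) p.1 ∧ gX Bh (Bh p.1) (gA A c p.2) ≠ p.1 then 1 else 0
    with ht4
  have herr : ∀ A c B Bh,
      ∑ p : α × β with gX Bh (Bh p.1) (gAB A B c (B (gA A c p.2))) ≠ p.1, P p ≤
        t1 A c + t2 A c + t3 A c B + t4 A c Bh := by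
    intro A c B Bh
    simp only [ht1, ht2, ht3, ht4, ← sum_add_distrib, ← mul_add]
    rw [sum_filter]
    refine sum_le_sum fun p _ => ?_
    rw [← mul_boole]
    refine mul_le_mul_of_nonneg_left (ite_le_add_of_imp fun he => ?_) (hP p)
    by_cases h1 : ∀ z, θ₁ ≤ V p.2 z → A z ≠ c
    · exact Or.inl h1
    push Not at h1
    obtain ⟨z, hz, hzc⟩ := h1
    obtain ⟨hg1, hg2⟩ := hgA A c p.2 ⟨z, hzc⟩
    have hsel : A (gA A c p.2) = c ∧ θ₁ ≤ V p.2 (gA A c p.2) := ⟨hg1, hz.trans (hg2 hzc)⟩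
    by_cases h2 : Q (gA A c p.2) < θ₂ ∨ R (gA A c p.2) p.1 < θ₃
    · exact Or.inr (Or.inl ⟨hsel, h2⟩)
    push Not at h2
    by_cases h3 : gAB A B c (B (gA A c p.2)) = gA A c p.2
    · rw [h3] at he
      exact Or.inr (Or.inr (Or.inr ⟨h2.2, he⟩))
    · exact Or.inr (Or.inr (Or.inl ⟨⟨hsel.1, h2.1⟩, h3⟩))
  have hb1 : ∑ A ∈ EA.fns, EA.prob A * ∑ c ∈ EA.im, t1 A c ≤
      M * (2 * ∑ p, P p * ∑ z with V p.2 z < θ₁ ∨ θ₀ < V p.2 z, V p.2 z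
        + (M * (1 + bA) * (2 * θ₀) + |aA - 1|)) := by
    have h1 : ∑ A ∈ EA.fns, EA.prob A * ∑ c ∈ EA.im, t1 A c = ∑ p, P p * ∑ A ∈ EA.fns,
        EA.prob A * ((EA.im.filter fun c => ∀ z, θ₁ ≤ V p.2 z → A z ≠ c).card : ℝ) := by
      simp only [ht1, mul_sum]
      simp only [sum_comm (s := EA.im)]
      rw [sum_comm]
      refine sum_congr rfl fun p _ => sum_congr rfl fun A _ => ?_
      rw [← mul_sum, ← mul_sum, sum_boole]
      ring
    rw [h1]
    refine (sum_le_sum fun p _ => mul_le_mul_of_nonneg_left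
      (sum_unhit_le hA hbA him (hV p.2) (hV1 p.2) hθ₀) (hP p)).trans (le_of_eq ?_)
    have h2 : ∀ p, P p * (M * (2 * ∑ z with V p.2 z < θ₁ ∨ θ₀ < V p.2 z, V p.2 z
        + (M * (1 + bA) * (2 * θ₀) + |aA - 1|))) =
        M * 2 * (P p * ∑ z with V p.2 z < θ₁ ∨ θ₀ < V p.2 z, V p.2 z)
        + P p * (M * (M * (1 + bA) * (2 * θ₀) + |aA - 1|)) := fun p => by ring
    simp only [← hMdef, h2, sum_add_distrib, ← mul_sum, ← sum_mul, hP1]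
    ring
  have hb2 : ∀ A, ∑ c ∈ EA.im, t2 A c ≤
      1 / θ₁ * ∑ p, P p * ∑ z with Q z < θ₂ ∨ R z p.1 < θ₃, V p.2 z := by
    intro A
    simp only [ht2]
    rw [sum_comm, mul_sum]
    refine sum_le_sum fun p _ => ?_
    rw [← mul_sum, sum_boole, mul_left_comm]
    exact mul_le_mul_of_nonneg_left (sum_selected_le (hV p.2) hθ₁ (fun c => gA A c p.2)
      fun z => Q z < θ₂ ∨ R z p.1 < θ₃) (hP p)
  have hb3 : ∀ A ∈ EA.fns, ∑ c ∈ EA.im, ∑ B ∈ EB.fns, EB.prob B * t3 A c B ≤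
      aB / (θ₂ * EB.im.card) + M * |bB| := by
    intro A hAf
    have h1 : ∑ c ∈ EA.im, ∑ B ∈ EB.fns, EB.prob B * t3 A c B = ∑ p, P p * ∑ c ∈ EA.im,
        ∑ B ∈ EB.fns with (A (gA A c p.2) = c ∧ θ₂ ≤ Q (gA A c p.2)) ∧
          gAB A B c (B (gA A c p.2)) ≠ gA A c p.2, EB.prob B := by
      simp only [ht3, mul_sum]
      simp only [sum_comm (s := EB.fns)]
      rw [sum_comm]
      refine sum_congr rfl fun p _ => sum_congr rfl fun c _ => ?_
      rw [sum_filter]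
      refine sum_congr rfl fun B _ => ?_
      split_ifs <;> ring
    rw [h1]
    refine (sum_le_sum fun p _ => mul_le_mul_of_nonneg_left (sum_decode_le hB haB hAf hQ hQ1 hθ₂
      (gAB := fun B c b => gAB A B c b) (hgAB A) fun c => gA A c p.2) (hP p)).trans ?_
    rw [← sum_mul, hP1, one_mul]
  have hb4 : ∀ A c, ∑ Bh ∈ EX.fns, EX.prob Bh * t4 A c Bh ≤
      aX / (θ₃ * EX.im.card) + |bX| := by
    intro A c
    have h1 : ∑ Bh ∈ EX.fns, EX.prob Bh * t4 A c Bh = ∑ p, P p *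
        ∑ Bh ∈ EX.fns with θ₃ ≤ R (gA A c p.2) p.1 ∧ gX Bh (Bh p.1) (gA A c p.2) ≠ p.1,
          EX.prob Bh := by
      simp only [ht4, mul_sum]
      rw [sum_comm]
      refine sum_congr rfl fun p _ => ?_
      rw [sum_filter]
      refine sum_congr rfl fun B _ => ?_
      split_ifs <;> ring
    rw [h1]
    refine (sum_le_sum fun p _ => mul_le_mul_of_nonneg_left (sum_decode_side_le hX haX
      (hR (gA A c p.2)) (hR1 _) hθ₃ (g := fun B b => gX B b (gA A c p.2))
      (fun B b => hgX B b _) p.1) (hP p)).trans ?_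
    rw [← sum_mul, hP1, one_mul]
  set e1 := 2 * ∑ p, P p * ∑ z with V p.2 z < θ₁ ∨ θ₀ < V p.2 z, V p.2 z
        + (M * (1 + bA) * (2 * θ₀) + |aA - 1|)
  set S2 := ∑ p, P p * ∑ z with Q z < θ₂ ∨ R z p.1 < θ₃, V p.2 z
  set e2 := 1 / (θ₁ * M) * S2 with he2
  set e3 := aB / (θ₂ * EB.im.card * M) + |bB| with he3
  have hM2 : M * e2 = 1 / θ₁ * S2 := by rw [he2]; field_simp
  have hM3 : M * e3 = aB / (θ₂ * EB.im.card) + M * |bB| := by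
    rw [he3, mul_add]; congr 1; field_simp
  -- `A` and then `c` are fixed with the mean over `B` still inside the average. Afterwards `B` and
  -- `Bh` can be chosen separately, the bound on `t4` being uniform in `A` and `c`.
  obtain ⟨A, hAf, hAle⟩ := exists_le_of_weighted_sum_le EA.prob_nonneg EA.sum_prob
    (f := fun A => ∑ c ∈ EA.im, (t1 A c + t2 A c + ∑ B ∈ EB.fns, EB.prob B * t3 A c B))
    (δ := M * (e1 + e2 + e3)) (by
      have h0 : M * e2 + M * e3 = ∑ A ∈ EA.fns, EA.prob A * (M * e2 + M * e3) := by
        rw [← sum_mul, EA.sum_prob, one_mul]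
      rw [add_assoc, mul_add M e1, mul_add M e2, h0]
      refine le_trans ?_ (add_le_add_left hb1 _)
      rw [← sum_add_distrib]
      refine sum_le_sum fun A hAf => ?_
      rw [← mul_add]
      refine mul_le_mul_of_nonneg_left ?_ (EA.prob_nonneg A hAf)
      rw [sum_add_distrib, sum_add_distrib, hM2, hM3]
      linarith [hb2 A, hb3 A hAf])
  obtain ⟨c, hc, hcle⟩ := exists_le_of_weighted_sum_le (s := EA.im) (w := fun _ => 1 / M)
    (fun _ _ => by positivity) (by rw [sum_const, nsmul_eq_mul, ← hMdef]; field_simp)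
    (f := fun c => t1 A c + t2 A c + ∑ B ∈ EB.fns, EB.prob B * t3 A c B)
    (δ := e1 + e2 + e3) (by
      rw [← mul_sum, one_div, ← div_eq_inv_mul, div_le_iff₀ hM, mul_comm]; exact hAle)
  obtain ⟨B, hBf, hBle⟩ := exists_le_of_weighted_sum_le EB.prob_nonneg EB.sum_prob
    (f := t3 A c) le_rfl
  obtain ⟨Bh, hBhf, hBhle⟩ := exists_le_of_weighted_sum_le EX.prob_nonneg EX.sum_prob
    (f := t4 A c) (hb4 A c)
  exact ⟨A, hAf, B, hBf, Bh, hBhf, c, hc, (herr A c B Bh).trans (by linarith)⟩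

/-! ### Memoryless extensions and Chernoff bounds -/

theorem prod_eq_two_rpow {ι : Type*} {s : Finset ι} {r : ι → ℝ} (hr : ∀ i ∈ s, 0 < r i) :
    ∏ i ∈ s, r i = (2 : ℝ) ^ (-∑ i ∈ s, Real.logb 2 (1 / r i)) := by
  rw [← sum_neg_distrib, Real.rpow_sum_of_pos two_pos]
  refine prod_congr rfl fun i hi => ?_
  rw [one_div, Real.logb_inv, neg_neg, Real.rpow_logb two_pos (by norm_num) (hr i hi)]

section Sequences

variable {X Y Z : Type*}

theorem sum_prod_triple [Fintype X] [Fintype Y] [Fintype Z] (G : (X × Y) × Z → ℝ) (n : ℕ) :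
    ∑ p : (Fin n → X) × (Fin n → Y), ∑ z : Fin n → Z, ∏ i, G ((p.1 i, p.2 i), z i) =
      (∑ t, G t) ^ n := by
  classical
  have h1 : (∑ t, G t) ^ n = ∏ _i : Fin n, ∑ x, ∑ y, ∑ z, G ((x, y), z) := by
    simp [Fintype.sum_prod_type]
  rw [h1, Fintype.sum_prod_type, prod_univ_sum, Fintype.piFinset_univ]
  refine sum_congr rfl fun x _ => ?_
  rw [prod_univ_sum, Fintype.piFinset_univ]
  refine sum_congr rfl fun y _ => ?_
  rw [prod_univ_sum, Fintype.piFinset_univ]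

/-- The joint law `μ_{XYZ}`. -/
def jointXYZ (μ : X × Y → ℝ) (W : Y → Z → ℝ) (t : (X × Y) × Z) : ℝ := μ t.1 * W t.1.2 t.2

variable {μ : X × Y → ℝ} {W : Y → Z → ℝ}

theorem jointXYZ_nonneg (hμ : ∀ p, 0 ≤ μ p) (hW : ∀ y z, 0 ≤ W y z) (t : (X × Y) × Z) :
    0 ≤ jointXYZ μ W t := mul_nonneg (hμ _) (hW _ _)

theorem sum_jointXYZ [Fintype X] [Fintype Y] [Fintype Z] (hμ1 : ∑ p, μ p = 1)
    (hW1 : ∀ y, ∑ z, W y z = 1) :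
    ∑ t, jointXYZ μ W t = 1 := by
  simp only [jointXYZ, Fintype.sum_prod_type (α₁ := X × Y), ← mul_sum, hW1, mul_one, hμ1]

open Classical in
/-- Chernoff bound for the memoryless extension of `μ_{XYZ}`. -/
theorem sum_bad_le [Fintype X] [Fintype Y] [Fintype Z] (hμ : ∀ p, 0 ≤ μ p) (hW : ∀ y z, 0 ≤ W y z)
    {n : ℕ}
    (f : (X × Y) × Z → ℝ) (a : ℝ) {l : ℝ} (hl : 0 ≤ l)
    (bad : (Fin n → X) × (Fin n → Y) → (Fin n → Z) → Prop)
    (hbad : ∀ p z, bad p z → (∀ i, 0 < jointXYZ μ W ((p.1 i, p.2 i), z i)) →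
      n * a ≤ ∑ i, f ((p.1 i, p.2 i), z i)) :
    ∑ p : (Fin n → X) × (Fin n → Y), seqProb μ (fun i => (p.1 i, p.2 i)) *
        ∑ z with bad p z, seqCondProb W p.2 z ≤
      (∑ t, jointXYZ μ W t * (2 : ℝ) ^ (l * (f t - a))) ^ n := by
  rw [← sum_prod_triple]
  refine sum_le_sum fun p _ => ?_
  rw [mul_sum, sum_filter]
  refine sum_le_sum fun z _ => ?_
  have hnn : ∀ i, 0 ≤ jointXYZ μ W ((p.1 i, p.2 i), z i) := fun i => jointXYZ_nonneg hμ hW _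
  have hR : 0 ≤ ∏ i, jointXYZ μ W ((p.1 i, p.2 i), z i) *
      (2 : ℝ) ^ (l * (f ((p.1 i, p.2 i), z i) - a)) :=
    prod_nonneg fun i _ => mul_nonneg (hnn i) (by positivity)
  split_ifs with hb
  · have heq : seqProb μ (fun i => (p.1 i, p.2 i)) * seqCondProb W p.2 z =
        ∏ i, jointXYZ μ W ((p.1 i, p.2 i), z i) := by
      simp only [seqProb, seqCondProb, jointXYZ, prod_mul_distrib]
    rw [heq]
    by_cases hpos : ∀ i, 0 < jointXYZ μ W ((p.1 i, p.2 i), z i)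
    · rw [prod_mul_distrib, ← Real.rpow_sum_of_pos two_pos]
      refine le_mul_of_one_le_right (prod_nonneg fun i _ => hnn i)
        (Real.one_le_rpow one_le_two ?_)
      rw [← mul_sum, sum_sub_distrib, sum_const, card_univ, Fintype.card_fin, nsmul_eq_mul]
      exact mul_nonneg hl (sub_nonneg.2 (hbad p z hb hpos))
    -- Sequences of probability zero contribute nothing, so the logarithms matter only on the
    -- support.
    · push Not at hpos
      obtain ⟨i, hi⟩ := hpos
      rw [prod_eq_zero (mem_univ i) (le_antisymm hi (hnn i))]
      exact hR
  · exact hR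

open Classical in
/-- The probability that the likelihood `∏ r` is below `2^{-na}`. -/
theorem sum_prod_lt_le [Fintype X] [Fintype Y] [Fintype Z] (hμ : ∀ p, 0 ≤ μ p)
    (hW : ∀ y z, 0 ≤ W y z) {n : ℕ}
    {r : (X × Y) × Z → ℝ} (hr : ∀ t, 0 < jointXYZ μ W t → 0 < r t) (a : ℝ) {l : ℝ} (hl : 0 ≤ l) :
    ∑ p : (Fin n → X) × (Fin n → Y), seqProb μ (fun i => (p.1 i, p.2 i)) *
        ∑ z with ∏ i, r ((p.1 i, p.2 i), z i) < (2 : ℝ) ^ (-(n * a)), seqCondProb W p.2 z ≤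
      (∑ t, jointXYZ μ W t * (2 : ℝ) ^ (l * (Real.logb 2 (1 / r t) - a))) ^ n := by
  refine sum_bad_le hμ hW (fun t => Real.logb 2 (1 / r t)) a hl
    (fun p z => ∏ i, r ((p.1 i, p.2 i), z i) < (2 : ℝ) ^ (-(n * a))) fun p z hb hpos => ?_
  rw [prod_eq_two_rpow fun i _ => hr _ (hpos i), Real.rpow_lt_rpow_left_iff one_lt_two] at hb
  linarith

open Classical in
/-- The probability that the likelihood `∏ r` is above `2^{-na}`. -/
theorem sum_lt_prod_le [Fintype X] [Fintype Y] [Fintype Z] (hμ : ∀ p, 0 ≤ μ p)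
    (hW : ∀ y z, 0 ≤ W y z) {n : ℕ}
    {r : (X × Y) × Z → ℝ} (hr : ∀ t, 0 < jointXYZ μ W t → 0 < r t) (a : ℝ) {l : ℝ} (hl : 0 ≤ l) :
    ∑ p : (Fin n → X) × (Fin n → Y), seqProb μ (fun i => (p.1 i, p.2 i)) *
        ∑ z with (2 : ℝ) ^ (-(n * a)) < ∏ i, r ((p.1 i, p.2 i), z i), seqCondProb W p.2 z ≤
      (∑ t, jointXYZ μ W t * (2 : ℝ) ^ (l * (-Real.logb 2 (1 / r t) - -a))) ^ n := by
  refine sum_bad_le hμ hW (fun t => -Real.logb 2 (1 / r t)) (-a) hl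
    (fun p z => (2 : ℝ) ^ (-(n * a)) < ∏ i, r ((p.1 i, p.2 i), z i)) fun p z hb hpos => ?_
  rw [prod_eq_two_rpow fun i _ => hr _ (hpos i), Real.rpow_lt_rpow_left_iff one_lt_two] at hb
  rw [sum_neg_distrib]
  linarith

/-! ### Marginals and entropies -/

theorem sum_jointXYZ_mul_yz [Fintype X] [Fintype Y] [Fintype Z] (g : Y → Z → ℝ) :
    ∑ t, jointXYZ μ W t * g t.1.2 t.2 = ∑ p, jointYZ μ W p * g p.1 p.2 := by
  simp only [jointXYZ, jointYZ, Fintype.sum_prod_type, sum_mul]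
  rw [sum_comm]
  exact sum_congr rfl fun y _ => sum_comm

theorem sum_jointXYZ_mul_xz [Fintype X] [Fintype Y] [Fintype Z] (g : X → Z → ℝ) :
    ∑ t, jointXYZ μ W t * g t.1.1 t.2 = ∑ p, jointXZ μ W p * g p.1 p.2 := by
  simp only [jointXYZ, jointXZ, Fintype.sum_prod_type, sum_mul]
  exact sum_congr rfl fun y _ => sum_comm

theorem jointYZ_eq [Fintype X] (p : Y × Z) : jointYZ μ W p = W p.1 p.2 * margSnd μ p.1 := by
  rw [jointYZ, margSnd, ← sum_mul, mul_comm]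

theorem margSnd_jointXZ [Fintype X] [Fintype Y] : margSnd (jointXZ μ W) = margSnd
    (jointYZ μ W) := by
  funext z
  exact sum_comm

theorem margFst_jointYZ [Fintype X] [Fintype Z] (hW1 : ∀ y, ∑ z, W y z = 1) :
    margFst (jointYZ μ W) = margSnd μ := by
  funext y
  simp only [margFst, jointYZ_eq, ← sum_mul, hW1, one_mul]

theorem condEntropy_eq [Fintype X] [Fintype Y] [Fintype Z] :
    condEntropy W (margSnd μ) = ∑ t, jointXYZ μ W t * Real.logb 2 (1 / W t.1.2 t.2) := by
  rw [sum_jointXYZ_mul_yz fun y z => Real.logb 2 (1 / W y z), Fintype.sum_prod_type]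
  simp only [jointYZ_eq, condEntropy]

/-- Also valid where the marginal vanishes: nonnegativity then forces `p (u, v) = 0`, consistent
with the default value 0 of the quotient. -/
theorem margSnd_mul_condFst {U V : Type*} [Fintype U] {p : U × V → ℝ} (hp : ∀ t, 0 ≤ p t)
    (u : U) (v : V) : condFst p v u * margSnd p v = p (u, v) := by
  rw [condFst]
  rcases eq_or_ne (margSnd p v) 0 with h | h
  · have : p (u, v) = 0 := (sum_eq_zero_iff_of_nonneg fun u _ => hp (u, v)).1 h u (mem_univ u)
    rw [h, this, mul_zero]
  · rw [div_mul_cancel₀ _ h]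

theorem condEntropyOf_eq {U V : Type*} [Fintype U] [Fintype V] {p : U × V → ℝ}
    (hp : ∀ t, 0 ≤ p t) :
    condEntropyOf p = ∑ t, p t * Real.logb 2 (1 / condFst p t.2 t.1) := by
  rw [condEntropyOf, condEntropy, sum_comm, Fintype.sum_prod_type]
  simp only [margSnd_mul_condFst hp]

theorem jointXZ_nonneg [Fintype Y] (hμ : ∀ p, 0 ≤ μ p) (hW : ∀ y z, 0 ≤ W y z) (t : X × Z) :
    0 ≤ jointXZ μ W t := sum_nonneg fun _ _ => mul_nonneg (hμ _) (hW _ _)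

theorem jointYZ_nonneg [Fintype X] (hμ : ∀ p, 0 ≤ μ p) (hW : ∀ y z, 0 ≤ W y z) (t : Y × Z) :
    0 ≤ jointYZ μ W t := sum_nonneg fun _ _ => mul_nonneg (hμ _) (hW _ _)

theorem condEntropyOf_jointXZ [Fintype X] [Fintype Y] [Fintype Z] (hμ : ∀ p, 0 ≤ μ p)
    (hW : ∀ y z, 0 ≤ W y z) :
    condEntropyOf (jointXZ μ W) =
      ∑ t, jointXYZ μ W t * Real.logb 2 (1 / condFst (jointXZ μ W) t.2 t.1.1) := by
  rw [condEntropyOf_eq (jointXZ_nonneg hμ hW),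
    sum_jointXYZ_mul_xz fun x z => Real.logb 2 (1 / condFst (jointXZ μ W) z x)]

/-- The chain rule `H(Z|Y) + I(Y;Z) = H(Z)`. -/
theorem condEntropy_add_mutualInfo [Fintype X] [Fintype Y] [Fintype Z] (hμ : ∀ p, 0 ≤ μ p)
    (hW : ∀ y z, 0 ≤ W y z)
    (hW1 : ∀ y, ∑ z, W y z = 1) :
    condEntropy W (margSnd μ) + mutualInfo (jointYZ μ W) =
      ∑ t, jointXYZ μ W t * Real.logb 2 (1 / margSnd (jointYZ μ W) t.2) := by
  have hJ := jointYZ_nonneg hμ hW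
  have hY : entropy (margFst (jointYZ μ W)) =
      ∑ p, jointYZ μ W p * Real.logb 2 (1 / margSnd μ p.1) := by
    rw [entropy, Fintype.sum_prod_type, margFst_jointYZ hW1]
    refine sum_congr rfl fun y _ => ?_
    simp only [jointYZ_eq, ← sum_mul, hW1, one_mul]
  rw [mutualInfo, hY, condEntropyOf_eq hJ, condEntropy_eq,
    sum_jointXYZ_mul_yz fun y z => Real.logb 2 (1 / W y z),
    sum_jointXYZ_mul_yz fun _ z => Real.logb 2 (1 / margSnd (jointYZ μ W) z),
    ← sum_sub_distrib, ← sum_add_distrib]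
  refine sum_congr rfl fun p _ => ?_
  rcases (hJ p).eq_or_lt with h | h
  · simp [← h]
  · have h1 := h
    rw [jointYZ_eq] at h1
    have hW0 : W p.1 p.2 ≠ 0 := fun h0 => by simp [h0] at h1
    have hM0 : margSnd μ p.1 ≠ 0 := fun h0 => by simp [h0] at h1
    have h2 := margSnd_mul_condFst hJ p.1 p.2
    have hC0 : condFst (jointYZ μ W) p.2 p.1 ≠ 0 := fun h0 => by
      rw [h0, zero_mul] at h2; exact h.ne h2
    have hZ0 : margSnd (jointYZ μ W) p.2 ≠ 0 := fun h0 => by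
      rw [h0, mul_zero] at h2; exact h.ne h2
    have h3 : Real.logb 2 (W p.1 p.2) + Real.logb 2 (margSnd μ p.1) =
        Real.logb 2 (condFst (jointYZ μ W) p.2 p.1)
          + Real.logb 2 (margSnd (jointYZ μ W) p.2) := by
      rw [← Real.logb_mul hW0 hM0, ← Real.logb_mul hC0 hZ0, h2, jointYZ_eq]
    simp only [one_div, Real.logb_inv]
    rw [← mul_sub, ← mul_add]
    congr 1
    linarith

theorem margSnd_jointYZ_pos [Fintype X] [Fintype Y] (hμ : ∀ p, 0 ≤ μ p) (hW : ∀ y z, 0 ≤ W y z)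
    {t : (X × Y) × Z}
    (ht : 0 < jointXYZ μ W t) : 0 < margSnd (jointYZ μ W) t.2 := by
  have h1 : jointXYZ μ W t ≤ jointYZ μ W (t.1.2, t.2) :=
    single_le_sum (f := fun x => μ (x, t.1.2) * W t.1.2 t.2)
      (fun _ _ => mul_nonneg (hμ _) (hW _ _)) (mem_univ t.1.1)
  have h2 : jointYZ μ W (t.1.2, t.2) ≤ margSnd (jointYZ μ W) t.2 :=
    single_le_sum (f := fun y => jointYZ μ W (y, t.2)) (fun _ _ => jointYZ_nonneg hμ hW _)
      (mem_univ t.1.2)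
  linarith

theorem condFst_jointXZ_pos [Fintype X] [Fintype Y] (hμ : ∀ p, 0 ≤ μ p) (hW : ∀ y z, 0 ≤ W y z)
    {t : (X × Y) × Z}
    (ht : 0 < jointXYZ μ W t) : 0 < condFst (jointXZ μ W) t.2 t.1.1 := by
  have h1 : jointXYZ μ W t ≤ jointXZ μ W (t.1.1, t.2) :=
    single_le_sum (f := fun y => μ (t.1.1, y) * W y t.2)
      (fun _ _ => mul_nonneg (hμ _) (hW _ _)) (mem_univ t.1.2)
  rw [condFst, margSnd_jointXZ]
  exact div_pos (ht.trans_le h1) (margSnd_jointYZ_pos hμ hW ht)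

theorem condFst_nonneg {U V : Type*} [Fintype U] {p : U × V → ℝ} (hp : ∀ t, 0 ≤ p t)
    (v : V) (u : U) : 0 ≤ condFst p v u :=
  div_nonneg (hp _) (sum_nonneg fun _ _ => hp _)

/-- Only an inequality, because the row is zero where the marginal vanishes. This is why
`exists_code` asks for subprobabilities `R`. -/
theorem sum_condFst_le_one {U V : Type*} [Fintype U] {p : U × V → ℝ} (v : V) :
    ∑ u, condFst p v u ≤ 1 := by
  simp only [condFst, ← sum_div]
  exact div_self_le_one _

theorem logb_one_div_nonneg {r : ℝ} (h0 : 0 ≤ r) (h1 : r ≤ 1) : 0 ≤ Real.logb 2 (1 / r) := by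
  rw [one_div, Real.logb_inv, neg_nonneg]
  exact Real.logb_nonpos one_lt_two h0 h1

/-- A large-deviation bound with exponent above `ε` at any level above `m + ζ(3ε)`. -/
theorem exists_exponent_of_lt {ι : Type*} [Fintype ι] {P f : ι → ℝ} {k K : ℕ} {ε η : ℝ}
    (hε : 0 < ε) (hk : 2 ≤ k) (hkK : k ≤ K) (hP : ∀ i, 0 ≤ P i) (hP1 : ∑ i, P i = 1)
    (hf : ∀ i, 0 ≤ f i) (hPf : ∑ i, P i * (2 : ℝ) ^ f i ≤ k) (hη : zetaFun K (3 * ε) < η) :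
    ∃ κ > 0, ∃ l > 0, ∑ i, P i * (2 : ℝ) ^ (l * (f i - ((∑ j, P j * f j) + η))) ≤
      (2 : ℝ) ^ (-(ε + κ)) := by
  obtain ⟨l, hl, h⟩ := exists_exponent hε hk hkK hP hP1 hf hPf
  -- Raising the level from ζ to `η` multiplies every term by `2^(-l (η - ζ))`. This surplus `κ`
  -- later absorbs the typicality slack.
  refine ⟨l * (η - zetaFun K (3 * ε)), mul_pos hl (sub_pos.2 hη), l, hl, ?_⟩
  have heq : ∀ i, P i * (2 : ℝ) ^ (l * (f i - ((∑ j, P j * f j) + η))) =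
      P i * (2 : ℝ) ^ (l * (f i - (∑ j, P j * f j) - zetaFun K (3 * ε)))
        * (2 : ℝ) ^ (-(l * (η - zetaFun K (3 * ε)))) := fun i => by
    rw [mul_assoc, ← Real.rpow_add two_pos]; congr 2; ring
  simp only [heq, ← sum_mul]
  refine (mul_le_mul_of_nonneg_right h (by positivity)).trans (le_of_eq ?_)
  rw [← Real.rpow_add two_pos]; congr 1; ring

/-- On the support, `p(u, v) / p(u | v)` is the marginal of `v`, and summing it over all pairs gives
`|U|`. -/
theorem sum_mul_two_rpow_logb_le {U V : Type*} [Fintype U] [Fintype V] {p : U × V → ℝ}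
    (hp : ∀ t, 0 ≤ p t) (hp1 : ∑ t, p t = 1) :
    ∑ t, p t * (2 : ℝ) ^ Real.logb 2 (1 / condFst p t.2 t.1) ≤ Fintype.card U := by
  have h : ∀ t, p t * (2 : ℝ) ^ Real.logb 2 (1 / condFst p t.2 t.1) ≤ margSnd p t.2 := by
    intro t
    have h2 := margSnd_mul_condFst hp t.1 t.2
    rcases (condFst_nonneg hp t.2 t.1).eq_or_lt with h | h
    · rw [← h, zero_mul] at h2
      rw [← Prod.mk.eta (p := t), ← h2, zero_mul]
      exact sum_nonneg fun _ _ => hp _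
    · rw [Real.rpow_logb two_pos (by norm_num) (by positivity), mul_one_div, div_le_iff₀ h,
        mul_comm, h2]
  refine (sum_le_sum fun t _ => h t).trans (le_of_eq ?_)
  rw [Fintype.sum_prod_type] at hp1 ⊢
  simp only [margSnd]
  rw [sum_const, sum_comm, hp1, card_univ, nsmul_eq_mul, mul_one]

end Sequences

/-! ### Lengths, image sizes and rates -/

section Lengths

variable {k : ℕ}

/-- The strict rounding bound forces `log k > 0`, so nontrivial alphabets are implicit in the length
conditions. -/
theorem two_le_of_isLength {l : ℕ} {t : ℝ} (h : IsLength l k t) : 2 ≤ k := by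
  by_contra hk
  have h0 : Real.logb 2 (k : ℝ) = 0 := by
    have : k = 0 ∨ k = 1 := by omega
    rcases this with rfl | rfl <;> simp
  have := (abs_nonneg _).trans_lt h
  linarith

theorem tendsto_two_rpow_mul {x : ℝ} (hx : x < 0) :
    Tendsto (fun n : ℕ => (2 : ℝ) ^ ((n : ℝ) * x)) atTop (𝓝 0) := by
  have : ∀ n : ℕ, (2 : ℝ) ^ ((n : ℝ) * x) = ((2 : ℝ) ^ x) ^ n := fun n => by
    rw [mul_comm, Real.rpow_mul two_pos.le, Real.rpow_natCast]
  simp only [this]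
  exact tendsto_pow_atTop_nhds_zero_of_lt_one (by positivity)
    (Real.rpow_lt_one_of_one_lt_of_neg one_lt_two hx)

theorem pow_eq_two_rpow {k : ℕ} (hk : 0 < k) (l : ℕ) :
    (k : ℝ) ^ l = (2 : ℝ) ^ ((l : ℝ) * Real.logb 2 k) := by
  rw [mul_comm, Real.rpow_mul two_pos.le, Real.rpow_logb two_pos (by norm_num)
    (Nat.cast_pos.2 hk), Real.rpow_natCast]

theorem im_card_le {α : Type*} [Fintype α] {U : Type*} [Fintype U] [DecidableEq U] {l : ℕ} {t : ℝ}
    (E : Ensemble α (Fin l → U)) (h : IsLength l (Fintype.card U) t) :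
    (E.im.card : ℝ) ≤ Fintype.card U * (2 : ℝ) ^ t := by
  have hk : 0 < Fintype.card U := by linarith [two_le_of_isLength h]
  have h1 : (E.im.card : ℝ) ≤ (Fintype.card U : ℝ) ^ l := by
    have := card_le_univ E.im
    rw [Fintype.card_fun, Fintype.card_fin] at this
    exact_mod_cast this
  refine h1.trans ?_
  rw [pow_eq_two_rpow hk]
  calc _ ≤ (2 : ℝ) ^ (Real.logb 2 (Fintype.card U) + t) :=
        Real.rpow_le_rpow_of_exponent_le one_le_two (by linarith [(abs_lt.1 h).2])
    _ = _ := by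
        rw [Real.rpow_add two_pos, Real.rpow_logb two_pos (by norm_num) (Nat.cast_pos.2 hk)]

/-- The deficit of the image is subexponential by the hash property and rounding costs at most one
symbol; each takes half of `τ`. -/
theorem le_im_card {α : ℕ → Type*} [∀ n, Fintype (α n)] [∀ n, Nonempty (α n)]
    {U : Type*} [Fintype U] [DecidableEq U] {l : ℕ → ℕ} {t : ℝ}
    (E : ∀ n, Ensemble (α n) (Fin (l n) → U))
    (h : ∀ n : ℕ, 0 < n → IsLength (l n) (Fintype.card U) (n * t))
    (him : Tendsto (fun n : ℕ => Real.logb 2 ((Fintype.card (Fin (l n) → U) : ℝ) /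
      ((E n).im.card : ℝ)) / (n : ℝ)) atTop (𝓝 0)) {τ : ℝ} (hτ : 0 < τ) :
    ∀ᶠ n : ℕ in atTop, (2 : ℝ) ^ ((n : ℝ) * (t - τ)) ≤ (E n).im.card := by
  have hk : 0 < Fintype.card U := by linarith [two_le_of_isLength (h 1 one_pos)]
  have h1 := him.eventually (gt_mem_nhds (half_pos hτ))
  have h2 := (tendsto_const_div_atTop_nhds_zero_nat (Real.logb 2 (Fintype.card U))).eventually
    (gt_mem_nhds (half_pos hτ))
  filter_upwards [h1, h2, eventually_gt_atTop 0] with n h1 h2 hn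
  have hn' : (0 : ℝ) < n := Nat.cast_pos.2 hn
  have hM : (0 : ℝ) < (E n).im.card := Nat.cast_pos.2 (E n).im_card_pos
  rw [div_lt_iff₀ hn'] at h1 h2
  have hc : (Fintype.card (Fin (l n) → U) : ℝ) =
      (2 : ℝ) ^ ((l n : ℝ) * Real.logb 2 (Fintype.card U)) := by
    rw [← pow_eq_two_rpow hk, Fintype.card_fun, Fintype.card_fin, Nat.cast_pow]
  rw [hc, Real.logb_div (by positivity) hM.ne', Real.logb_rpow two_pos (by norm_num)] at h1
  rw [← Real.le_logb_iff_rpow_le one_lt_two hM]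
  have := (abs_lt.1 (h n hn)).1
  linarith

theorem abs_rate_sub_lt {l n : ℕ} (hn : 0 < n) {R : ℝ} (h : IsLength l k (n * R)) :
    |rate l k n - R| < Real.logb 2 k / n := by
  have hn' : (0 : ℝ) < n := Nat.cast_pos.2 hn
  have : rate l k n - R = ((l : ℝ) * Real.logb 2 k - n * R) / n := by
    rw [rate]; field_simp
  rw [this, abs_div, abs_of_pos hn']
  exact div_lt_div_of_pos_right h hn'

theorem rate_eq {l n : ℕ} (hn : 0 < n) {R : ℝ} (h : IsLength l k (n * R))
    (hj : ∃ j : ℕ, (j : ℝ) * Real.logb 2 k = n * R) : rate l k n = R := by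
  have hn' : (0 : ℝ) < n := Nat.cast_pos.2 hn
  obtain ⟨j, hj⟩ := hj
  have hlog : 0 < Real.logb 2 k := (abs_nonneg _).trans_lt h
  rw [IsLength, ← hj, ← sub_mul, abs_mul, abs_of_pos hlog, mul_lt_iff_lt_one_left hlog] at h
  have hlj : l = j := by
    have : |(l : ℤ) - j| < 1 := by exact_mod_cast h
    have := Int.abs_lt_one_iff.1 this
    omega
  rw [rate, hlj, hj, mul_div_cancel_left₀ _ hn'.ne']

end Lengths

/-! ### Exponents of the source likelihoods -/

section Exponents

variable {X Y Z : Type*} {μ : X × Y → ℝ} {W : Y → Z → ℝ}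

theorem sum_jointXZ [Fintype X] [Fintype Y] [Fintype Z] (hμ1 : ∑ p, μ p = 1)
    (hW1 : ∀ y, ∑ z, W y z = 1) :
    ∑ p, jointXZ μ W p = 1 := by
  have := sum_jointXYZ_mul_xz (μ := μ) (W := W) fun _ _ => 1
  simpa [sum_jointXYZ hμ1 hW1] using this.symm

theorem sum_margSnd_jointYZ [Fintype X] [Fintype Y] [Fintype Z] (hμ1 : ∑ p, μ p = 1)
    (hW1 : ∀ y, ∑ z, W y z = 1) :
    ∑ z, margSnd (jointYZ μ W) z = 1 := by
  have := sum_jointXYZ_mul_yz (μ := μ) (W := W) fun _ _ => 1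
  simp only [mul_one, sum_jointXYZ hμ1 hW1, Fintype.sum_prod_type] at this
  rw [this, sum_comm]
  rfl

theorem margSnd_jointYZ_nonneg [Fintype X] [Fintype Y] (hμ : ∀ p, 0 ≤ μ p) (hW : ∀ y z, 0 ≤ W y z)
    (z : Z) :
    0 ≤ margSnd (jointYZ μ W) z := sum_nonneg fun _ _ => jointYZ_nonneg hμ hW _

/-- Large deviations of the likelihood of `Z`. -/
theorem exists_exponent_Z [Fintype X] [Fintype Y] [Fintype Z] (hμ : ∀ p, 0 ≤ μ p)
    (hμ1 : ∑ p, μ p = 1) (hW : ∀ y z, 0 ≤ W y z)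
    (hW1 : ∀ y, ∑ z, W y z = 1) (hk : 2 ≤ Fintype.card Z) {ε η : ℝ} (hε : 0 < ε)
    (hη : zetaFun (Fintype.card Z) (3 * ε) < η) :
    ∃ κ > 0, ∃ l > 0, ∑ t, jointXYZ μ W t * (2 : ℝ) ^ (l *
      (Real.logb 2 (1 / margSnd (jointYZ μ W) t.2)
        - (condEntropy W (margSnd μ) + mutualInfo (jointYZ μ W) + η))) ≤
      (2 : ℝ) ^ (-(ε + κ)) := by
  rw [condEntropy_add_mutualInfo hμ hW hW1]
  have h0 := margSnd_jointYZ_nonneg hμ hW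
  have h1 := sum_margSnd_jointYZ hμ1 hW1
  refine exists_exponent_of_lt hε hk le_rfl (jointXYZ_nonneg hμ hW) (sum_jointXYZ hμ1 hW1)
    (fun t => logb_one_div_nonneg (h0 _)
      (h1 ▸ single_le_sum (fun z _ => h0 z) (mem_univ t.2))) ?_ hη
  rw [sum_jointXYZ_mul_yz fun _ z =>
    (2 : ℝ) ^ Real.logb 2 (1 / margSnd (jointYZ μ W) z), Fintype.sum_prod_type, sum_comm]
  have : ∀ z, ∑ y, jointYZ μ W (y, z) * (2 : ℝ) ^ Real.logb 2 (1 / margSnd (jointYZ μ W) z)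
      ≤ 1 := by
    intro z
    rw [← sum_mul, show ∑ y, jointYZ μ W (y, z) = margSnd (jointYZ μ W) z from rfl]
    rcases (h0 z).eq_or_lt with h | h
    · rw [← h, zero_mul]; exact zero_le_one
    · rw [Real.rpow_logb two_pos (by norm_num) (by positivity), mul_one_div, div_self h.ne']
  refine (sum_le_sum fun z _ => this z).trans ?_
  simp

/-- Large deviations of the conditional likelihood of `X` given `Z`. -/
theorem exists_exponent_XZ [Fintype X] [Fintype Y] [Fintype Z] (hμ : ∀ p, 0 ≤ μ p)
    (hμ1 : ∑ p, μ p = 1) (hW : ∀ y z, 0 ≤ W y z)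
    (hW1 : ∀ y, ∑ z, W y z = 1) (hk : 2 ≤ Fintype.card X) (hZ : 0 < Fintype.card Z) {ε η : ℝ}
    (hε : 0 < ε) (hη : zetaFun (Fintype.card X * Fintype.card Z) (3 * ε) < η) :
    ∃ κ > 0, ∃ l > 0, ∑ t, jointXYZ μ W t * (2 : ℝ) ^ (l *
      (Real.logb 2 (1 / condFst (jointXZ μ W) t.2 t.1.1)
        - (condEntropyOf (jointXZ μ W) + η))) ≤ (2 : ℝ) ^ (-(ε + κ)) := by
  rw [condEntropyOf_jointXZ hμ hW]
  have h0 := condFst_nonneg (jointXZ_nonneg hμ hW)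
  refine exists_exponent_of_lt hε hk (Nat.le_mul_of_pos_right _ hZ) (jointXYZ_nonneg hμ hW)
    (sum_jointXYZ hμ1 hW1) (fun t => logb_one_div_nonneg (h0 _ _)
      ((single_le_sum (fun x _ => h0 t.2 x) (mem_univ t.1.1)).trans (sum_condFst_le_one t.2)))
    ?_ hη
  rw [sum_jointXYZ_mul_xz fun x z =>
    (2 : ℝ) ^ Real.logb 2 (1 / condFst (jointXZ μ W) z x)]
  exact sum_mul_two_rpow_logb_le (jointXZ_nonneg hμ hW) (sum_jointXZ hμ1 hW1)

theorem seqProb_nonneg {U : Type*} {n : ℕ} {p : U → ℝ} (hp : ∀ u, 0 ≤ p u) (u : Fin n → U) :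
    0 ≤ seqProb p u := prod_nonneg fun _ _ => hp _

theorem sum_seqProb {U : Type*} [Fintype U] (n : ℕ) (p : U → ℝ) :
    ∑ u : Fin n → U, seqProb p u = (∑ u, p u) ^ n := by
  classical
  have : (∑ u, p u) ^ n = ∏ _i : Fin n, ∑ u, p u := by simp
  rw [this, prod_univ_sum, Fintype.piFinset_univ]
  rfl

theorem seqCondProb_nonneg {U V : Type*} {n : ℕ} {q : V → U → ℝ} (hq : ∀ v u, 0 ≤ q v u)
    (v : Fin n → V) (u : Fin n → U) : 0 ≤ seqCondProb q v u := prod_nonneg fun _ _ => hq _ _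

theorem sum_seqCondProb {U V : Type*} [Fintype U] {n : ℕ} (q : V → U → ℝ) (v : Fin n → V) :
    ∑ u, seqCondProb q v u = ∏ i, ∑ u, q (v i) u := by
  classical
  rw [prod_univ_sum, Fintype.piFinset_univ]
  rfl

theorem sum_seqProb_pair [Fintype X] [Fintype Y] (n : ℕ) (hμ1 : ∑ p, μ p = 1) :
    ∑ p : (Fin n → X) × (Fin n → Y), seqProb μ (fun i => (p.1 i, p.2 i)) = 1 := by
  rw [← one_pow n, ← hμ1, ← sum_seqProb]
  exact Fintype.sum_equiv (Equiv.arrowProdEquivProdArrow (Fin n) (fun _ => X) (fun _ => Y)).symm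
    _ _ fun _ => rfl

open Classical in
theorem sum_filter_or_le {α : Type*} (s : Finset α) (P Q : α → Prop) {f : α → ℝ}
    (hf : ∀ a, 0 ≤ f a) :
    ∑ a ∈ s with P a ∨ Q a, f a ≤ ∑ a ∈ s with P a, f a + ∑ a ∈ s with Q a, f a := by
  rw [filter_or, ← sum_union_inter]
  exact le_add_of_nonneg_right (sum_nonneg fun a _ => hf a)

end Exponents

theorem HasHashPropertyWith.hashBound {U : Type*} [Fintype U] [DecidableEq U] {V : ℕ → Type*}
    [∀ n, Fintype (V n)] [∀ n, DecidableEq (V n)] {E : ∀ n, Ensemble (Fin n → U) (V n)}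
    {a b : ℕ → ℝ} (h : HasHashPropertyWith E a b) {n : ℕ} (hn : 0 < n) :
    (E n).HashBound (a n) (b n) := h.hash n hn

/-! ### Typicality and low-likelihood events for blocks -/

section Main

variable {X Y Z : Type*} [Fintype X] [Fintype Y] [Fintype Z]
  {μ : X × Y → ℝ} {W : Y → Z → ℝ}

open Classical in
/-- The conditional likelihood of `Z` given `Y` is exponentially concentrated. -/
theorem exists_atypical_le (hμ : ∀ p, 0 ≤ μ p) (hμ1 : ∑ p, μ p = 1) (hW : ∀ y z, 0 ≤ W y z)
    (hW1 : ∀ y, ∑ z, W y z = 1) {τ : ℝ} (hτ : 0 < τ) :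
    ∃ r : ℕ → ℝ, Tendsto r atTop (𝓝 0) ∧ ∀ n : ℕ,
      ∑ p : (Fin n → X) × (Fin n → Y), seqProb μ (fun i => (p.1 i, p.2 i)) *
        ∑ z with seqCondProb W p.2 z < (2 : ℝ) ^ (-(n * (condEntropy W (margSnd μ) + τ))) ∨
          (2 : ℝ) ^ (-(n * (condEntropy W (margSnd μ) - τ))) < seqCondProb W p.2 z,
          seqCondProb W p.2 z ≤ r n := by
  have hP1 := sum_jointXYZ hμ1 hW1
  have hH := condEntropy_eq (μ := μ) (W := W)
  obtain ⟨l₁, hl₁, h₁⟩ := exists_sum_mul_rpow_lt_one hP1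
    (f := fun t => Real.logb 2 (1 / W t.1.2 t.2)) (a := condEntropy W (margSnd μ) + τ)
    (by rw [← hH]; linarith)
  obtain ⟨l₀, hl₀, h₀⟩ := exists_sum_mul_rpow_lt_one hP1
    (f := fun t => -Real.logb 2 (1 / W t.1.2 t.2)) (a := -(condEntropy W (margSnd μ) - τ))
    (by simp only [mul_neg, sum_neg_distrib]; rw [← hH]; linarith)
  have hnn : ∀ (l : ℝ) (f : (X × Y) × Z → ℝ), 0 ≤ ∑ t, jointXYZ μ W t * (2 : ℝ) ^ (l * f t) :=
    fun l f => sum_nonneg fun t _ => mul_nonneg (jointXYZ_nonneg hμ hW t) (by positivity)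
  have hpos : ∀ t : (X × Y) × Z, 0 < jointXYZ μ W t → 0 < W t.1.2 t.2 := fun t ht =>
    pos_of_mul_pos_right ht (hμ _)
  have hlim := (tendsto_pow_atTop_nhds_zero_of_lt_one
    (hnn l₁ fun t => Real.logb 2 (1 / W t.1.2 t.2) - (condEntropy W (margSnd μ) + τ)) h₁).add
    (tendsto_pow_atTop_nhds_zero_of_lt_one
    (hnn l₀ fun t => -Real.logb 2 (1 / W t.1.2 t.2) - -(condEntropy W (margSnd μ) - τ)) h₀)
  rw [add_zero] at hlim
  refine ⟨_, hlim, fun n => ?_⟩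
  refine le_trans (sum_le_sum fun p _ => mul_le_mul_of_nonneg_left (sum_filter_or_le univ
    (fun z => seqCondProb W p.2 z < (2 : ℝ) ^ (-(n * (condEntropy W (margSnd μ) + τ))))
    (fun z => (2 : ℝ) ^ (-(n * (condEntropy W (margSnd μ) - τ))) < seqCondProb W p.2 z)
    (seqCondProb_nonneg hW p.2)) (seqProb_nonneg hμ _)) ?_
  simp only [mul_add, sum_add_distrib]
  simp only [← mul_add]
  exact add_le_add
    (sum_prod_lt_le hμ hW (r := fun t => W t.1.2 t.2) hpos _ hl₁.le)
    (sum_lt_prod_le hμ hW (r := fun t => W t.1.2 t.2) hpos _ hl₀.le)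

open Classical in
/-- Under `μ_{XYZ}`, low likelihoods have probability exponentially smaller than `2^{-nε}`. -/
theorem exists_low_likelihood_le (hμ : ∀ p, 0 ≤ μ p) (hμ1 : ∑ p, μ p = 1)
    (hW : ∀ y z, 0 ≤ W y z) (hW1 : ∀ y, ∑ z, W y z = 1) (hX : 2 ≤ Fintype.card X)
    (hZ : 2 ≤ Fintype.card Z) {ε η₂ η₃ : ℝ} (hε : 0 < ε)
    (hη₂ : zetaFun (Fintype.card Z) (3 * ε) < η₂)
    (hη₃ : zetaFun (Fintype.card X * Fintype.card Z) (3 * ε) < η₃) :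
    ∃ κ₂ > 0, ∃ κ₃ > 0, ∀ n : ℕ,
      ∑ p : (Fin n → X) × (Fin n → Y), seqProb μ (fun i => (p.1 i, p.2 i)) *
        ∑ z with seqProb (margSnd (jointYZ μ W)) z <
            (2 : ℝ) ^ (-(n * (condEntropy W (margSnd μ) + mutualInfo (jointYZ μ W) + η₂))) ∨
          seqCondProb (condFst (jointXZ μ W)) z p.1 <
            (2 : ℝ) ^ (-(n * (condEntropyOf (jointXZ μ W) + η₃))), seqCondProb W p.2 z ≤
      (2 : ℝ) ^ ((n : ℝ) * -(ε + κ₂)) + (2 : ℝ) ^ ((n : ℝ) * -(ε + κ₃)) := by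
  obtain ⟨κ₂, hκ₂, l₂, hl₂, h₂⟩ := exists_exponent_Z hμ hμ1 hW hW1 hZ hε hη₂
  obtain ⟨κ₃, hκ₃, l₃, hl₃, h₃⟩ := exists_exponent_XZ hμ hμ1 hW hW1 hX (by omega) hε hη₃
  have hnn : ∀ (l : ℝ) (f : (X × Y) × Z → ℝ), 0 ≤ ∑ t, jointXYZ μ W t * (2 : ℝ) ^ (l * f t) :=
    fun l f => sum_nonneg fun t _ => mul_nonneg (jointXYZ_nonneg hμ hW t) (by positivity)
  have hpow : ∀ (n : ℕ) (x : ℝ), ((2 : ℝ) ^ x) ^ n = (2 : ℝ) ^ ((n : ℝ) * x) := fun n x => by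
    rw [mul_comm, Real.rpow_mul two_pos.le, Real.rpow_natCast]
  refine ⟨κ₂, hκ₂, κ₃, hκ₃, fun n => ?_⟩
  refine le_trans (sum_le_sum fun p _ => mul_le_mul_of_nonneg_left (sum_filter_or_le univ
      (fun z => seqProb (margSnd (jointYZ μ W)) z <
            (2 : ℝ) ^ (-(n * (condEntropy W (margSnd μ) + mutualInfo (jointYZ μ W) + η₂))))
      (fun z => seqCondProb (condFst (jointXZ μ W)) z p.1 <
            (2 : ℝ) ^ (-(n * (condEntropyOf (jointXZ μ W) + η₃))))
      (seqCondProb_nonneg hW p.2)) (seqProb_nonneg hμ _)) ?_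
  simp only [mul_add, sum_add_distrib]
  simp only [← mul_add]
  refine add_le_add ?_ ?_
  · rw [← hpow]
    exact (sum_prod_lt_le hμ hW (r := fun t => margSnd (jointYZ μ W) t.2)
      (fun t ht => margSnd_jointYZ_pos hμ hW ht) _ hl₂.le).trans
      (pow_le_pow_left₀ (hnn l₂ fun t => _) h₂ n)
  · rw [← hpow]
    exact (sum_prod_lt_le hμ hW (r := fun t => condFst (jointXZ μ W) t.2 t.1.1)
      (fun t ht => condFst_jointXZ_pos hμ hW ht) _ hl₃.le).trans
      (pow_le_pow_left₀ (hnn l₃ fun t => _) h₃ n)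

end Main

/-! ### Assembly of the error bound -/

theorem tendsto_error_bound {r aA bA aB bB aX bX : ℕ → ℝ} (hr : Tendsto r atTop (𝓝 0))
    (haA : Tendsto aA atTop (𝓝 1)) (hbA : Tendsto bA atTop (𝓝 0)) (haB : Tendsto aB atTop (𝓝 1))
    (hbB : Tendsto bB atTop (𝓝 0)) (haX : Tendsto aX atTop (𝓝 1)) (hbX : Tendsto bX atTop (𝓝 0))
    (k : ℝ) {x₁ x₂ x₃ x₄ x₅ : ℝ} (h₁ : x₁ < 0) (h₂ : x₂ < 0) (h₃ : x₃ < 0) (h₄ : x₄ < 0)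
    (h₅ : x₅ < 0) :
    Tendsto (fun n : ℕ => (2 * r n + (k * (1 + bA n) * 2 * (2 : ℝ) ^ ((n : ℝ) * x₁) + |aA n - 1|))
      + ((2 : ℝ) ^ ((n : ℝ) * x₂) + (2 : ℝ) ^ ((n : ℝ) * x₃))
      + (aB n * (2 : ℝ) ^ ((n : ℝ) * x₄) + |bB n|)
      + (aX n * (2 : ℝ) ^ ((n : ℝ) * x₅) + |bX n|)) atTop (𝓝 0) := by
  have := ((((hr.const_mul 2).add (((((hbA.const_add 1).const_mul k).mul_const 2).mul
    (tendsto_two_rpow_mul h₁)).add (haA.sub_const 1).abs)).add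
    ((tendsto_two_rpow_mul h₂).add (tendsto_two_rpow_mul h₃))).add
    ((haB.mul (tendsto_two_rpow_mul h₄)).add hbB.abs)).add
    ((haX.mul (tendsto_two_rpow_mul h₅)).add hbX.abs)
  simpa using this

end HelpCode

theorem mainTheorem6 {X Y Z : Type*} [Fintype X] [DecidableEq X] [Fintype Y] [Fintype Z]
    [DecidableEq Z]
    -- the law of the memoryless source pair and the fixed conditional distribution of Z given Y
    (μXY : X × Y → ℝ) (hμ : μXY ∈ stdSimplex ℝ (X × Y))
    (W : Y → Z → ℝ) (hW : ∀ y, W y ∈ stdSimplex ℝ Z)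
    (εA εB εBh : ℝ) (hεA : 0 < εA) (hεB : 0 < εB) (hεBh : 0 < εBh)
    (hB : εB > εA + zetaFun (Fintype.card Z) (3 * εA))
    (hBh : εBh > 2 * zetaFun (Fintype.card X * Fintype.card Z) (3 * εA))
    -- the lengths of the values of the functions, up to rounding
    (lA lB lBh : ℕ → ℕ)
    (hlA : ∀ n, 0 < n →
      IsLength (lA n) (Fintype.card Z) (n * (condEntropy W (margSnd μXY) - εA)))
    (hlB : ∀ n, 0 < n →
      IsLength (lB n) (Fintype.card Z) (n * (mutualInfo (jointYZ μXY W) + εB)))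
    (hlBh : ∀ n, 0 < n →
      IsLength (lBh n) (Fintype.card X) (n * (condEntropyOf (jointXZ μXY W) + εBh)))
    (EA : ∀ n, Ensemble (Fin n → Z) (Fin (lA n) → Z))
    (EB : ∀ n, Ensemble (Fin n → Z) (Fin (lB n) → Z))
    (EBh : ∀ n, Ensemble (Fin n → X) (Fin (lBh n) → X))
    (hashA : HasHashProperty EA) (hashB : HasHashProperty EB) (hashBh : HasHashProperty EBh) :
    ∀ δ : ℝ, 0 < δ → ∀ᶠ n in atTop,
      -- all maximum-likelihood maps, with arbitrary tie-breaking
      ∀ (gA : ((Fin n → Z) → (Fin (lA n) → Z)) → (Fin (lA n) → Z) → (Fin n → Y) → (Fin n → Z))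
        (gAB : ((Fin n → Z) → (Fin (lA n) → Z)) → ((Fin n → Z) → (Fin (lB n) → Z)) →
          (Fin (lA n) → Z) → (Fin (lB n) → Z) → (Fin n → Z))
        (gBh : ((Fin n → X) → (Fin (lBh n) → X)) → (Fin (lBh n) → X) → (Fin n → Z) →
          (Fin n → X)),
      (∀ A c y, IsArgmax (coset A c) (seqCondProb W y) (gA A c y)) →
      (∀ A B c b, IsArgmax (cosetPair A B c b)
        (seqProb (margSnd (jointYZ μXY W))) (gAB A B c b)) →
      (∀ Bh b z, IsArgmax (coset Bh b)
        (seqCondProb (condFst (jointXZ μXY W)) z) (gBh Bh b z)) →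
      ∃ A ∈ (EA n).fns, ∃ B ∈ (EB n).fns, ∃ Bh ∈ (EBh n).fns, ∃ c ∈ (EA n).im,
        -- `R_X = H(X|Z) + ε_B̂`, up to rounding of the length
        |rate (lBh n) (Fintype.card X) n - (condEntropyOf (jointXZ μXY W) + εBh)|
            < Real.logb 2 (Fintype.card X) / n ∧
        ((∃ k : ℕ, (k : ℝ) * Real.logb 2 (Fintype.card X)
              = n * (condEntropyOf (jointXZ μXY W) + εBh)) →
          rate (lBh n) (Fintype.card X) n = condEntropyOf (jointXZ μXY W) + εBh) ∧
        -- `R_Y = I(Y;Z) + ε_B`, up to rounding of the length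
        |rate (lB n) (Fintype.card Z) n - (mutualInfo (jointYZ μXY W) + εB)|
            < Real.logb 2 (Fintype.card Z) / n ∧
        ((∃ k : ℕ, (k : ℝ) * Real.logb 2 (Fintype.card Z)
              = n * (mutualInfo (jointYZ μXY W) + εB)) →
          rate (lB n) (Fintype.card Z) n = mutualInfo (jointYZ μXY W) + εB) ∧
        errorProb μXY
            (fun x => Bh x)
            (fun y => B (gA A c y))
            (fun bX bY => gBh Bh bX (gAB A B c bY)) ≤ δ := by
  intro δ hδ
  have hμ0 := hμ.1
  have hμ1 := hμ.2
  have hW0 : ∀ y z, 0 ≤ W y z := fun y => (hW y).1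
  have hW1 : ∀ y, ∑ z, W y z = 1 := fun y => (hW y).2
  have hZ : 2 ≤ Fintype.card Z := two_le_of_isLength (hlA 1 one_pos)
  have hX : 2 ≤ Fintype.card X := two_le_of_isLength (hlBh 1 one_pos)
  have : Nonempty Z := Fintype.card_pos_iff.1 (by omega)
  have : Nonempty X := Fintype.card_pos_iff.1 (by omega)
  obtain ⟨aA, bA, hA⟩ := hashA
  obtain ⟨aB, bB, hB'⟩ := hashB
  obtain ⟨aX, bX, hX'⟩ := hashBh
  -- Nonnegativity turns `2 ζ < εBh` into `ζ < εBh`, which is what decoding `x` requires.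
  have hζ := zetaFun_nonneg (K := Fintype.card X * Fintype.card Z) hεA (by nlinarith)
  obtain ⟨η₂, hη₂, hη₂'⟩ := exists_between (show zetaFun (Fintype.card Z) (3 * εA) < εB - εA by
    linarith)
  obtain ⟨η₃, hη₃, hη₃'⟩ := exists_between
    (show zetaFun (Fintype.card X * Fintype.card Z) (3 * εA) < εBh by linarith)
  obtain ⟨κ₂, hκ₂, κ₃, hκ₃, hlow⟩ :=
    exists_low_likelihood_le hμ0 hμ1 hW0 hW1 hX hZ hεA hη₂ hη₃
  -- `τ` is the common slack for typicality and for image sizes, a quarter of the smallest margin.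
  obtain ⟨τ, hτ, hτA, hτB, hτX, hτ₂, hτ₃⟩ : ∃ τ > 0, τ < εA ∧ 2 * τ < εB - εA - η₂ ∧
      τ < εBh - η₃ ∧ 2 * τ < κ₂ ∧ 2 * τ < κ₃ := by
    have hpos : 0 < min εA (min (εB - εA - η₂) (min (εBh - η₃) (min κ₂ κ₃))) := by
      simp only [lt_min_iff]
      exact ⟨hεA, by linarith, by linarith, hκ₂, hκ₃⟩
    obtain ⟨m, hm⟩ : ∃ m, m = min εA (min (εB - εA - η₂) (min (εBh - η₃) (min κ₂ κ₃))) :=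
      ⟨_, rfl⟩
    rw [← hm] at hpos
    have hle := hm.le
    simp only [le_min_iff] at hle
    exact ⟨m / 4, by linarith, by linarith, by linarith, by linarith, by linarith, by linarith⟩
  obtain ⟨r, hr, hatyp⟩ := exists_atypical_le hμ0 hμ1 hW0 hW1 hτ
  -- `x₁` belongs to saturation. `x₂`, `x₃` are the change-of-measure cost `εA + 2τ` minus the
  -- exponents `εA + κ₂`, `εA + κ₃`. `x₄` and `x₅` come from the collisions of `B` and `Bh`; `x₄ <
  -- 0` is where `εB > εA + ζ` enters.
  have hG := tendsto_error_bound hr hA.tendsto_one hA.tendsto_zero hB'.tendsto_one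
    hB'.tendsto_zero hX'.tendsto_one hX'.tendsto_zero (Fintype.card Z)
    (x₁ := τ - εA) (x₂ := 2 * τ - κ₂) (x₃ := 2 * τ - κ₃) (x₄ := η₂ + εA - εB + 2 * τ)
    (x₅ := η₃ - εBh + τ) (by linarith) (by linarith) (by linarith) (by linarith) (by linarith)
  set H := condEntropy W (margSnd μXY) with hHdef
  set I := mutualInfo (jointYZ μXY W) with hIdef
  set HX := condEntropyOf (jointXZ μXY W) with hHXdef
  filter_upwards [eventually_gt_atTop 0, hG.eventually (gt_mem_nhds hδ),
    le_im_card EA hlA hA.im_large hτ, le_im_card EB hlB hB'.im_large hτ,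
    le_im_card EBh hlBh hX'.im_large hτ,
    -- The hash sequences carry no sign conditions, so the signs needed by `exists_code` hold only
    -- for large `n`.
    hA.tendsto_zero.eventually (lt_mem_nhds (show (-1 : ℝ) < 0 by norm_num)),
    hB'.tendsto_one.eventually (lt_mem_nhds (show (0 : ℝ) < 1 by norm_num)),
    hX'.tendsto_one.eventually (lt_mem_nhds (show (0 : ℝ) < 1 by norm_num))]
    with n hn hGn hMA hMB hMX hbA haB haX gA gAB gBh hgA hgAB hgBh
  have two_pow_pos : ∀ x : ℝ, 0 < (2 : ℝ) ^ x := fun x => Real.rpow_pos_of_pos two_pos x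
  have hMA' := im_card_le (EA n) (hlA n hn)
  obtain ⟨A, hAf, B, hBf, Bh, hBhf, c, hc, herr⟩ := exists_code (hA.hashBound hn)
    (hB'.hashBound hn) (hX'.hashBound hn) (by linarith) haB.le haX.le
    (P := fun p : (Fin n → X) × (Fin n → Y) => seqProb μXY fun i => (p.1 i, p.2 i))
    (V := seqCondProb W) (Q := seqProb (margSnd (jointYZ μXY W)))
    (R := seqCondProb (condFst (jointXZ μXY W)))
    (fun p => seqProb_nonneg hμ0 _) (sum_seqProb_pair n hμ1) (seqCondProb_nonneg hW0)
    (fun y => by rw [sum_seqCondProb]; exact prod_eq_one fun i _ => hW1 _)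
    (seqProb_nonneg (margSnd_jointYZ_nonneg hμ0 hW0))
    (by rw [sum_seqProb, sum_margSnd_jointYZ hμ1 hW1, one_pow])
    (seqCondProb_nonneg (condFst_nonneg (jointXZ_nonneg hμ0 hW0)))
    (fun z => by
      rw [sum_seqCondProb]
      exact prod_le_one (fun i _ => sum_nonneg fun x _ =>
        condFst_nonneg (jointXZ_nonneg hμ0 hW0) _ _) fun i _ => sum_condFst_le_one _)
    -- The thresholds `θ₀`, `θ₁` bracket typical likelihoods of `z` given `y`. `θ₂` and `θ₃` lie
    -- `η₂` and `η₃` beyond the entropies H(Z) and H(X|Z), with `H + I` standing for H(Z).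
    (two_pow_pos (-(n * (H - τ)))) (two_pow_pos (-(n * (H + τ))))
    (two_pow_pos (-(n * (H + I + η₂)))) (two_pow_pos (-(n * (HX + η₃)))) hgA hgAB hgBh
  refine ⟨A, hAf, B, hBf, Bh, hBhf, c, hc, abs_rate_sub_lt hn (hlBh n hn),
    rate_eq hn (hlBh n hn), abs_rate_sub_lt hn (hlB n hn), rate_eq hn (hlB n hn), ?_⟩
  refine (herr.trans ?_).trans hGn.le
  have hA0 := two_pow_pos (n * (H - εA - τ))
  have hB0 := two_pow_pos (n * (I + εB - τ))
  have hX0 := two_pow_pos (n * (HX + εBh - τ))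
  refine add_le_add (add_le_add (add_le_add (add_le_add ?_ (add_le_add_left ?_ _)) ?_)
    (add_le_add_left ?_ _)) (add_le_add_left ?_ _)
  · exact mul_le_mul_of_nonneg_left (hatyp n) two_pos.le
  · have h1 : (2 : ℝ) ^ (n * (H - εA)) * (2 : ℝ) ^ (-(n * (H - τ))) =
        (2 : ℝ) ^ (n * (τ - εA)) := by
      rw [← Real.rpow_add two_pos]; congr 1; ring
    calc _ ≤ Fintype.card Z * (2 : ℝ) ^ (n * (H - εA)) * (1 + bA n)
          * (2 * (2 : ℝ) ^ (-(n * (H - τ)))) := by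
          refine mul_le_mul_of_nonneg_right (mul_le_mul_of_nonneg_right hMA' ?_) ?_
          · linarith
          · positivity
      _ = _ := by rw [← h1]; ring
  · have h1 : 1 / ((2 : ℝ) ^ (-(n * (H + τ))) * (EA n).im.card) ≤
        (2 : ℝ) ^ (n * (εA + 2 * τ)) := by
      have : (2 : ℝ) ^ (n * (εA + 2 * τ)) =
          1 / ((2 : ℝ) ^ (-(n * (H + τ))) * (2 : ℝ) ^ (n * (H - εA - τ))) := by
        rw [← Real.rpow_add two_pos, one_div, ← Real.rpow_neg two_pos.le]; congr 1; ring
      rw [this]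
      gcongr
    have h2 := mul_le_mul h1 (hlow n) (sum_nonneg fun p _ => mul_nonneg (seqProb_nonneg hμ0 _)
      (sum_nonneg fun z _ => seqCondProb_nonneg hW0 _ _)) (two_pow_pos _).le
    refine h2.trans (le_of_eq ?_)
    rw [mul_add, ← Real.rpow_add two_pos, ← Real.rpow_add two_pos]
    congr 2 <;> ring
  · have h1 : (2 : ℝ) ^ (n * (η₂ + εA - εB + 2 * τ)) =
        1 / ((2 : ℝ) ^ (-(n * (H + I + η₂))) * (2 : ℝ) ^ (n * (I + εB - τ))
          * (2 : ℝ) ^ (n * (H - εA - τ))) := by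
      rw [← Real.rpow_add two_pos, ← Real.rpow_add two_pos, one_div, ← Real.rpow_neg two_pos.le]
      congr 1; ring
    rw [h1, mul_one_div]
    gcongr
  · have h1 : (2 : ℝ) ^ (n * (η₃ - εBh + τ)) =
        1 / ((2 : ℝ) ^ (-(n * (HX + η₃))) * (2 : ℝ) ^ (n * (HX + εBh - τ))) := by
      rw [← Real.rpow_add two_pos, one_div, ← Real.rpow_neg two_pos.le]
      congr 1; ring
    rw [h1, mul_one_div]
    gcongr
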